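/- Let $d\ge 1$, $k\in\{0,\dots,d-1\}$, $r>0$, let $B_r^d=\{x\in\mathbb R^d:\|x\|\le r\}$, let $\kappa_j$ be the volume of the unit ball of $\mathbb R^j$ ($\kappa_0=1$), let $S_+^{d-1}=\{v\in\mathbb R^d:\|v\|=1,\ v_d\ge 0\}$, and let $\Theta$ be the uniform distribution on $S_+^{d-1}$. For $p\in\mathbb R$ and $v\in S_+^{d-1}$ put $H(p,v)=\{x\in\mathbb R^d:\langle x,v\rangle=p\}$. Let $\Phi$ be the stationary isotropic Poisson hyperplane process of intensity $\lambda>0$, that is, the process of hyperplanes $H(P_i,V_i)$, where $\sum_i\delta_{(P_i,V_i)}$ is a Poisson process on $\mathbb R\times S_+^{d-1}$ with intensity measure $\lambda\,dp\,\Theta(dv)$. Let $\nu_k$ be $k$-dimensional volume ($k$-dimensional Hausdorff measure normalized to be Lebesgue measure on $k$-flats; counting measure for $k=0$), and let $\chi(K)=1$ if $K\neq\emptyset$, $\chi(\emptyset)=0$. Put $$\Psi_k(B_r^d)=\frac1{(d-k)!}\sum_{H_1,\dots,H_{d-k}}\mathbf 1\{H_1\cap\dots\cap H_{d-k}\text{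 is a }k\text{-flat that meets }B_r^d\},$$ $$\zeta_k(B_r^d)=\frac1{(d-k)!}\sum_{H_1,\dots,H_{d-k}}\nu_k(H_1\cap\dots\cap H_{d-k}\cap B_r^d),$$ where the sums run over all $(d-k)$-tuples of pairwise distinct hyperplanes of $\Phi$. Let $X_1,\dots,X_{2(d-k)-1}$ be i.i.d. random elements of $[-r,r]\times S_+^{d-1}$ whose law is the product of the uniform distribution on $[-r,r]$ and $\Theta$, and put $$\sigma_{\chi,k}^{(1,d-k)}=\mathbb E\Big[\chi\Big(\bigcap_{i=1}^{d-k}H(X_i)\cap B_r^d\Big)\,\chi\Big(\bigcap_{i=d-k}^{2d-2k-1}H(X_i)\cap B_r^d\Big)\Big],$$ $$\sigma_{\nu,k}^{(1,d-k)}=r^{-2k}\,\mathbb E\Big[\nu_k\Big(\bigcap_{i=1}^{d-k}H(X_i)\cap B_r^d\Big)\,\nu_k\Big(\bigcap_{i=d-k}^{2d-2k-1}H(X_i)\cap B_r^d\Big)\Big].$$ Then $$\mathbb E\Psi_k(B_r^d)=\lambda_k\kappa_{d-k}r^{d-k},\qquad \mathbb E\zeta_k(B_r^d)=\lambda_k\kappa_d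 r^d,\qquad\text{where } \lambda_k=\binom dk\frac{\kappa_d}{\kappa_k}\Big(\frac{\kappa_{d-1}}{d\kappa_d}\Big)^{d-k}\lambda^{d-k}.$$ Moreover, for every $r>0$, $$\sigma_{\chi,k}^{(1,d-k)}=\frac{(\kappa_{d-k-1}(d-k-1)!)^2}{(2d-2k-1)!}\Big(\frac{d!\,\kappa_d}{k!\,\kappa_k}\Big)^2\Big(\frac{\kappa_{d-1}}{d\kappa_d}\Big)^{2(d-k)},$$ $$\sigma_{\nu,k}^{(1,d-k)}=\frac{(2^k\kappa_{d-1}(d-1)!)^2}{(2d-1)!}\Big(\frac{d!\,\kappa_d}{k!\,\kappa_k}\Big)^2\Big(\frac{\kappa_{d-1}}{d\kappa_d}\Big)^{2(d-k)}.$$ -/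

import Mathlib

open MeasureTheory ProbabilityTheory Set
open scoped ENNReal Nat

noncomputable section

namespace PoissonHyperplane

/-- Euclidean space `ℝ^d`. -/
abbrev E (d : ℕ) : Type := EuclideanSpace ℝ (Fin d)

/-- The closed ball `B_r^d` of radius `r` centred at the origin. -/
def originBall (d : ℕ) (r : ℝ) : Set (E d) := Metric.closedBall 0 r

/-- `κ_j`, the volume of the unit ball of `ℝ^j`. -/
def kappa (j : ℕ) : ℝ := (volume : Measure (E j)).real (originBall j 1)

/-- The upper unit hemisphere: unit vectors whose last coordinate is nonnegative. -/
def upperHemisphere (d : ℕ) : Set (Metric.sphere (0 : E d) 1) :=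
  {v | ∀ i : Fin d, i.val + 1 = d → 0 ≤ (v : E d) i}

/-- The uniform distribution on the upper hemisphere: normalized surface measure. -/
def uniformHemisphere (d : ℕ) : Measure (upperHemisphere d) :=
  (((volume : Measure (E d)).toSphere (upperHemisphere d))⁻¹ •
    (volume : Measure (E d)).toSphere).comap Subtype.val

/-- A hyperplane is parametrized by its signed distance `p` to the origin and a normal `v`. -/
abbrev Param (d : ℕ) : Type := ℝ × upperHemisphere d

/-- The hyperplane `H(p, v) = {x : ⟨x, v⟩ = p}`. -/
def hyperplane {d : ℕ} (x : Param d) : AffineSubspace ℝ (E d) where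
  carrier := {y | inner ℝ y (x.2.1 : E d) = x.1}
  smul_vsub_vadd_mem' := by
    intro c p₁ p₂ p₃ h₁ h₂ h₃
    simp only [mem_ofPred_eq] at h₁ h₂ h₃ ⊢
    simp only [vsub_eq_sub, vadd_eq_add, inner_add_left, inner_smul_left, inner_sub_left,
      h₁, h₂, h₃]
    simp

/-- `η` is a Poisson process on `X` with intensity measure `Λ`: a random locally finite
counting measure whose values on sets of finite intensity are Poisson distributed and whose
values on pairwise disjoint sets are independent. -/
structure IsPoissonProcess {Ω X : Type*} [MeasurableSpace Ω] [TopologicalSpace X]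
    [MeasurableSpace X] (P : Measure Ω) (η : Ω → Measure X) (Λ : Measure X) : Prop where
  locallyFinite : ∀ ω, IsLocallyFiniteMeasure (η ω)
  counting : ∀ ω (B : Set X), MeasurableSet B → ∃ n : ℕ∞, η ω B = (n : ℝ≥0∞)
  measurable : ∀ B : Set X, MeasurableSet B → Measurable (fun ω => η ω B)
  poisson : ∀ B : Set X, MeasurableSet B → Λ B ≠ ∞ → ∀ n : ℕ,
    P {ω | η ω B = (n : ℝ≥0∞)} = poissonMeasure (Λ B).toNNReal {n}
  indep : ∀ (n : ℕ) (B : Fin n → Set X), (∀ i, MeasurableSet (B i)) →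
    Pairwise (fun i j => Disjoint (B i) (B j)) → iIndepFun (fun i ω => η ω (B i)) P

/-- `Ψ` is the marked point process of a stationary Poisson hyperplane process in `ℝ^d` with
intensity `lam` and spherical orientation distribution `Θ`: the Poisson process of pairs
`(P_i, V_i)` with intensity measure `lam · dp ⊗ Θ(dv)`. -/
def IsStationaryPoissonHyperplaneProcess {Ω : Type*} [MeasurableSpace Ω] {d : ℕ}
    (P : Measure Ω) (Ψ : Ω → Measure (Param d)) (lam : ℝ)
    (Θ : Measure (upperHemisphere d)) : Prop :=
  IsPoissonProcess P Ψ (ENNReal.ofReal lam • (volume : Measure ℝ).prod Θ)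

/-- The support of the hyperplane process with parameter process `ψ`: all hyperplanes
`H(p, v)` with `(p, v)` an atom of `ψ`. -/
def supp {d : ℕ} (ψ : Measure (Param d)) : Set (AffineSubspace ℝ (E d)) :=
  {H | ∃ x : Param d, ψ {x} ≠ 0 ∧ H = hyperplane x}

/-- The set of all `k`-dimensional affine subspaces of `ℝ^d`. -/
def flats (d k : ℕ) : Set (AffineSubspace ℝ (E d)) :=
  {L | (L : Set (E d)).Nonempty ∧ Module.finrank ℝ L.direction = k}

/-- The `k`-flat intersection process `Φ_k`, evaluated at a set `B` of affine subspaces: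
the sum of `1_B(H₁ ∩ ⋯ ∩ H_{d-k})` over all tuples of pairwise distinct hyperplanes
of the process, divided by `(d-k)!`. -/
def flatProcess {d : ℕ} (k : ℕ) (ψ : Measure (Param d))
    (B : Set (AffineSubspace ℝ (E d))) : ℝ≥0∞ :=
  ((d - k)! : ℝ≥0∞)⁻¹ * ∑' H : Fin (d - k) ↪ supp ψ,
    B.indicator (fun _ => (1 : ℝ≥0∞)) (⨅ j, (H j : AffineSubspace ℝ (E d)))

/-- `Ψ_k(B_r^d)`: the number of `k`-flats of the intersection process hitting `B_r^d`. -/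
def numberHitting {d : ℕ} (k : ℕ) (ψ : Measure (Param d)) (r : ℝ) : ℝ≥0∞ :=
  flatProcess k ψ {L | L ∈ flats d k ∧ ((L : Set (E d)) ∩ originBall d r).Nonempty}

/-- `ν_k`: the `k`-dimensional Hausdorff measure in `ℝ^d`, normalized so that it is Lebesgue
measure on `k`-flats (and counting measure for `k = 0`). -/
def nu (d k : ℕ) : Measure (E d) := Measure.euclideanHausdorffMeasure k

/-- `ζ_k(B)`: the total `k`-volume in `B` of the `k`-flats of the intersection process, the
indicator in the definition of `Φ_k` being replaced by `ν_k(H₁ ∩ ⋯ ∩ H_{d-k} ∩ B)`. -/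
def totalVolume {d : ℕ} (k : ℕ) (ψ : Measure (Param d)) (B : Set (E d)) : ℝ≥0∞ :=
  ((d - k)! : ℝ≥0∞)⁻¹ * ∑' H : Fin (d - k) ↪ supp ψ,
    nu d k (((⨅ j, (H j : AffineSubspace ℝ (E d)) : AffineSubspace ℝ (E d)) : Set (E d)) ∩ B)

open Classical in
/-- `χ(K) = 1` if `K` is nonempty and `χ(∅) = 0`. -/
def chi {d : ℕ} (K : Set (E d)) : ℝ≥0∞ := if K.Nonempty then 1 else 0

/-- The law of `X_i = (P_i, V_i)`: independent components, `P_i` uniform on `[-r, r]` and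
`V_i` with distribution `Θ`. -/
def sampleLaw {d : ℕ} (r : ℝ) (Θ : Measure (upperHemisphere d)) : Measure (Param d) :=
  ((ENNReal.ofReal (2 * r))⁻¹ • (volume : Measure ℝ).restrict (Icc (-r) r)).prod Θ

/-- For the sample `X₁, …, X_{2m-1}` (indexed by `0, …, 2m-2`), the intersection
`H(X₁) ∩ ⋯ ∩ H(X_m) ∩ B_r^d`. -/
def firstSection {d : ℕ} (m : ℕ) (r : ℝ) (x : Fin (2 * m - 1) → Param d) : Set (E d) :=
  {y | (∀ i, i.val < m → y ∈ hyperplane (x i)) ∧ y ∈ originBall d r}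

/-- For the sample `X₁, …, X_{2m-1}` (indexed by `0, …, 2m-2`), the intersection
`H(X_m) ∩ ⋯ ∩ H(X_{2m-1}) ∩ B_r^d`. -/
def secondSection {d : ℕ} (m : ℕ) (r : ℝ) (x : Fin (2 * m - 1) → Param d) : Set (E d) :=
  {y | (∀ i, m ≤ i.val + 1 → y ∈ hyperplane (x i)) ∧ y ∈ originBall d r}

/-- `σ_{χ,k}^{(1,d-k)}`, computed with the ball of radius `r`. -/
def sigmaChi {d : ℕ} (k : ℕ) (r : ℝ) (Θ : Measure (upperHemisphere d)) : ℝ≥0∞ :=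
  ∫⁻ x : Fin (2 * (d - k) - 1) → Param d,
    chi (firstSection (d - k) r x) * chi (secondSection (d - k) r x)
    ∂Measure.pi (fun _ => sampleLaw r Θ)

/-- `σ_{ν,k}^{(1,d-k)}`, computed with the ball of radius `r`. -/
def sigmaNu {d : ℕ} (k : ℕ) (r : ℝ) (Θ : Measure (upperHemisphere d)) : ℝ≥0∞ :=
  (ENNReal.ofReal (r ^ (2 * k)))⁻¹ *
  ∫⁻ x : Fin (2 * (d - k) - 1) → Param d,
    nu d k (firstSection (d - k) r x) * nu d k (secondSection (d - k) r x)
    ∂Measure.pi (fun _ => sampleLaw r Θ)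

/-- The intensity `λ_k` of the `k`-flat intersection process of an isotropic Poisson
hyperplane process with intensity `lam`. -/
def flatIntensity (d k : ℕ) (lam : ℝ) : ℝ :=
  (d.choose k : ℝ) * (kappa d / kappa k) * (kappa (d - 1) / (d * kappa d)) ^ (d - k) *
    lam ^ (d - k)

end PoissonHyperplane

end

open PoissonHyperplane

/-! ### Ball volumes and sections of a ball by flats -/

namespace PoissonHyperplane

/-! Everything reduces to a Crofton formula for one function. The `n`-volume of the section of the
ball by an `n`-flat depends only on the distance from the origin to the flat; this is
`sectionVolume`, with `n = 0` giving `χ` and `n = k` giving `ν_k`.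

Cut a flat `S` of dimension `j` by `H(p, v)`. The squared distance of the new flat is that of `S`
plus the square of an affine function of `p` of slope `1/‖u‖`, where `u` is the projection of `v` to
the direction of `S`. Integration over `p` is therefore Cavalieri's principle: it gives `‖u‖` times
`sectionVolume (n + 1)` at the distance of `S` (`lintegral_sectionVolume_inf_hyperplane`). The mean
of `‖u‖` over `v` is `meanProj d j`, found by a Gaussian integral (`lintegral_toSphere_norm_proj`).
Iteration yields `lintegral_sectionVolume_cut`, and the product of the mean projections telescopes.

For the expectations, the Campbell formula `lintegral_distinct` replaces the sum over distinct
tuples by an integral against a power of the intensity measure, and the iteration starts from the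
whole space. It rests on independence over disjoint cells, almost sure simplicity, and almost sure
injectivity of the parametrization on the atoms.

For the second-order constants, given the shared hyperplane the two sections are independent and
identically distributed, so the inner integral is squared. The iteration starts from a hyperplane at
distance `|p|`, and it remains to integrate `sectionVolume ^ 2` in `p`. That square is a multiple of
`sectionVolume` in twice the dimension, so the result is again a ball volume. -/

theorem kappa_eq (n : ℕ) : kappa n = √Real.pi ^ n / Real.Gamma (n / 2 + 1) := by
  rcases n with _ | n
  · simp [kappa, originBall, measureReal_def, volume_euclideanSpace_eq_dirac]
  · rw [kappa, originBall, measureReal_def, EuclideanSpace.volume_closedBall]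
    have : 0 < Real.Gamma (((n + 1 : ℕ) : ℝ) / 2 + 1) := Real.Gamma_pos_of_pos (by positivity)
    simp only [ENNReal.ofReal_one, one_pow, one_mul, Fintype.card_fin]
    rw [ENNReal.toReal_ofReal (by positivity)]

theorem kappa_pos (n : ℕ) : 0 < kappa n := by
  rw [kappa_eq]
  have : 0 < Real.Gamma ((n : ℝ) / 2 + 1) := Real.Gamma_pos_of_pos (by positivity)
  positivity

theorem kappa_zero : kappa 0 = 1 := by simp [kappa_eq]

theorem volume_closedBall_zero (n : ℕ) {ρ : ℝ} (hρ : 0 ≤ ρ) :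
    volume (Metric.closedBall (0 : E n) ρ) = ENNReal.ofReal (kappa n * ρ ^ n) := by
  rcases n with _ | n
  · simp [kappa_zero, volume_euclideanSpace_eq_dirac, hρ]
  · rw [EuclideanSpace.volume_closedBall, kappa_eq, ← ENNReal.ofReal_pow hρ,
      ← ENNReal.ofReal_mul (by positivity)]
    simp [mul_comm]

/-- The `n`-volume of the section of the ball of radius `r` by an `n`-flat at distance `t`
from the centre. -/
noncomputable def sectionVolume (n : ℕ) (r : ℝ) (t : ℝ≥0∞) : ℝ≥0∞ :=
  if t ≤ ENNReal.ofReal r then ENNReal.ofReal (kappa n * √(r ^ 2 - t.toReal ^ 2) ^ n) else 0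

theorem measurable_sectionVolume (n : ℕ) (r : ℝ) : Measurable (sectionVolume n r) := by
  unfold sectionVolume
  refine Measurable.ite measurableSet_Iic ?_ measurable_const
  fun_prop

/-- The measure-preserving identification of `ℝ^(n+1)` with `ℝ × ℝ^n`. -/
theorem measurePreserving_cons (n : ℕ) :
    MeasurePreserving (fun x : E (n + 1) => ((x 0, WithLp.toLp 2 (fun i => x i.succ)) : ℝ × E n))
      volume (volume.prod volume) := by
  have h1 := PiLp.volume_preserving_ofLp (Fin (n + 1))
  have h2 := volume_preserving_piFinSuccAbove (fun _ : Fin (n + 1) => ℝ) 0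
  have h3 := (MeasurePreserving.id (volume : Measure ℝ)).prod (PiLp.volume_preserving_toLp (Fin n))
  exact (h3.comp (h2.comp h1))

/-- Cavalieri: the integrand is the volume of the slice of the `(n+1)`-ball at first coordinate `q`.
-/
theorem lintegral_sectionVolume (n : ℕ) {ρ : ℝ} (hρ : 0 ≤ ρ) :
    ∫⁻ q : ℝ, sectionVolume n ρ ‖q‖ₑ = ENNReal.ofReal (kappa (n + 1) * ρ ^ (n + 1)) := by
  rw [← volume_closedBall_zero (n + 1) hρ]
  set A : Set (ℝ × E n) := {x | x.1 ^ 2 + ‖x.2‖ ^ 2 ≤ ρ ^ 2} with hA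
  have hAm : MeasurableSet A := by
    apply measurableSet_le <;> fun_prop
  have hpre : (fun x : E (n + 1) => ((x 0, WithLp.toLp 2 (fun i => x i.succ)) : ℝ × E n)) ⁻¹' A
      = Metric.closedBall (0 : E (n + 1)) ρ := by
    ext x
    simp only [hA, mem_preimage, mem_ofPred_eq, Metric.mem_closedBall, dist_zero_right]
    rw [← sq_le_sq₀ (norm_nonneg x) hρ, EuclideanSpace.norm_sq_eq, EuclideanSpace.norm_sq_eq,
      Fin.sum_univ_succ]
    simp
  rw [← hpre, (measurePreserving_cons n).measure_preimage hAm.nullMeasurableSet,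
    Measure.prod_apply hAm]
  refine lintegral_congr fun q => ?_
  have hle : ‖q‖ₑ ≤ ENNReal.ofReal ρ ↔ q ^ 2 ≤ ρ ^ 2 := by
    rw [← ofReal_norm, ENNReal.ofReal_le_ofReal_iff hρ, ← sq_le_sq₀ (norm_nonneg q) hρ]
    simp
  rw [sectionVolume]
  split_ifs with h
  · rw [hle] at h
    rw [← volume_closedBall_zero n (Real.sqrt_nonneg _)]
    congr 1
    ext y
    simp only [hA, mem_preimage, mem_ofPred_eq, Metric.mem_closedBall, dist_zero_right,
      toReal_enorm, Real.norm_eq_abs, sq_abs]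
    rw [Real.le_sqrt (norm_nonneg y) (by linarith)]
    constructor <;> intro h <;> linarith
  · rw [hle] at h
    have : Prod.mk q ⁻¹' A = ∅ := by
      ext y
      simp only [hA, mem_preimage, mem_ofPred_eq, mem_empty_iff_false, iff_false]
      nlinarith [sq_nonneg ‖y‖]
    rw [this, measure_empty]

/-- The Gamma values at `N + 1` and `N + 3/2` are a factorial and a double factorial; this ratio is
the source of the factorials in the second-order constants. -/
theorem kappa_odd_div_even (N : ℕ) :
    kappa (2 * N + 1) = kappa (2 * N) * (2 ^ (2 * N + 1) * (N ! : ℝ) ^ 2 / ((2 * N + 1)! : ℝ)) := by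
  have h2 : (0:ℝ) < (N ! : ℝ) := by positivity
  have hs : √Real.pi ≠ 0 := by positivity
  have e : (((2 * N + 1 : ℕ) : ℝ) / 2 + 1) = ((N + 1 : ℕ) : ℝ) + 1 / 2 := by push_cast; ring
  have e' : (((2 * N : ℕ) : ℝ) / 2 + 1) = (N : ℝ) + 1 := by push_cast; ring
  rw [kappa_eq, kappa_eq, e, e', Real.Gamma_nat_eq_factorial, Real.Gamma_nat_add_half]
  have h3 : ((2 * N + 1)! : ℝ) = ((2 * (N + 1) - 1)‼ : ℕ) * (2 ^ N * (N ! : ℝ)) := by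
    have := Nat.factorial_eq_mul_doubleFactorial (2 * N)
    rw [Nat.doubleFactorial_two_mul] at this
    rw [this, show 2 * (N + 1) - 1 = 2 * N + 1 by omega]
    push_cast; ring
  have h4 : (0 : ℝ) < ((2 * (N + 1) - 1)‼ : ℕ) := by exact_mod_cast Nat.doubleFactorial_pos _
  rw [h3]
  field_simp
  ring

/-- Squaring doubles the exponent of the radius, so the integrand is `κ_n² / κ_{2n}` times a
`2n`-dimensional section volume and Cavalieri applies in dimension `2n + 1`. -/
theorem lintegral_sectionVolume_sq (n : ℕ) {r : ℝ} (hr : 0 ≤ r) :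
    ∫⁻ q : ℝ, sectionVolume n r ‖q‖ₑ ^ 2 = ENNReal.ofReal (kappa n ^ 2 *
      (2 ^ (2 * n + 1) * (n ! : ℝ) ^ 2 / ((2 * n + 1)! : ℝ)) * r ^ (2 * n + 1)) := by
  have key : ∀ q : ℝ, sectionVolume n r ‖q‖ₑ ^ 2 =
      ENNReal.ofReal (kappa n ^ 2 / kappa (2 * n)) * sectionVolume (2 * n) r ‖q‖ₑ := by
    intro q
    unfold sectionVolume
    split_ifs
    · have h1 := kappa_pos n
      have h2 := kappa_pos (2 * n)
      rw [← ENNReal.ofReal_pow (by positivity), ← ENNReal.ofReal_mul (by positivity)]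
      congr 1
      rw [pow_mul]
      field_simp
      rw [← pow_mul, ← pow_mul, mul_comm]
    · simp
  simp_rw [key]
  have hm : Measurable fun q : ℝ => sectionVolume (2 * n) r ‖q‖ₑ :=
    (measurable_sectionVolume _ _).comp measurable_enorm
  have h1 := kappa_pos n
  have h2 := kappa_pos (2 * n)
  rw [lintegral_const_mul _ hm, lintegral_sectionVolume _ hr, kappa_odd_div_even,
    ← ENNReal.ofReal_mul (by positivity)]
  congr 1
  field_simp

end PoissonHyperplane

open scoped Pointwise

namespace PoissonHyperplane

/-! ### Polar coordinates and the mean length of a projection -/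

section Polar

variable {V : Type*} [NormedAddCommGroup V] [InnerProductSpace ℝ V] [FiniteDimensional ℝ V]
  [MeasurableSpace V] [BorelSpace V]

theorem lintegral_polar [Nontrivial V] (F : V → ℝ≥0∞) :
    ∫⁻ x, F x = ∫⁻ p, F (p.2.1 • (p.1 : V)) ∂((volume : Measure V).toSphere.prod
      (Measure.volumeIoiPow (Module.finrank ℝ V - 1))) := by
  have h := (volume : Measure V).measurePreserving_homeomorphUnitSphereProd
  have h0 : ∫⁻ x, F x = ∫⁻ x in ({0}ᶜ : Set V), F x := by rw [restrict_compl_singleton]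
  rw [← h.lintegral_comp_emb (Homeomorph.measurableEmbedding _), h0,
    ← lintegral_subtype_comap (measurableSet_singleton _).compl]
  refine lintegral_congr fun x => ?_
  congr 1
  have hx : ‖(x : V)‖ ≠ 0 := norm_ne_zero_iff.2 x.2
  simp [smul_smul, hx]

theorem lintegral_volumeIoiPow (n : ℕ) (f : ℝ → ℝ≥0∞) (hf : Measurable f) :
    ∫⁻ t, f t.1 ∂(Measure.volumeIoiPow n) = ∫⁻ t in Ioi (0:ℝ), ENNReal.ofReal (t ^ n) * f t := by
  rw [Measure.volumeIoiPow, lintegral_withDensity_eq_lintegral_mul _ (by fun_prop) (by fun_prop)]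
  exact lintegral_subtype_comap measurableSet_Ioi (fun t : ℝ => ENNReal.ofReal (t ^ n) * f t)

/-- Polar integration of a positively homogeneous function against the Gaussian weight. -/
theorem lintegral_gaussian_homogeneous [Nontrivial V] (g : V → ℝ) (hg : Measurable g)
    (h0 : ∀ x, 0 ≤ g x) (hom : ∀ (t : ℝ) x, 0 < t → g (t • x) = t * g x) :
    ∫⁻ x : V, ENNReal.ofReal (g x * Real.exp (-‖x‖ ^ 2)) =
      (∫⁻ v, ENNReal.ofReal (g v) ∂(volume : Measure V).toSphere) *
        ENNReal.ofReal (Real.Gamma ((Module.finrank ℝ V + 1 : ℝ) / 2) / 2) := by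
  have hn : 0 < Module.finrank ℝ V := Module.finrank_pos
  set n := Module.finrank ℝ V with hn_def
  rw [lintegral_polar]
  have h1 : ∀ p : Metric.sphere (0 : V) 1 × Ioi (0:ℝ),
      ENNReal.ofReal (g (p.2.1 • (p.1 : V)) * Real.exp (-‖p.2.1 • (p.1 : V)‖ ^ 2)) =
      ENNReal.ofReal (g p.1) * ENNReal.ofReal (p.2.1 * Real.exp (-p.2.1 ^ 2)) := by
    rintro ⟨v, t, ht⟩
    have ht' : 0 < t := ht
    rw [← ENNReal.ofReal_mul (h0 _)]
    simp only [norm_smul, hom t _ ht']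
    simp [abs_of_pos ht']
    congr 1; ring
  simp_rw [h1]
  have hm1 : Measurable fun v : Metric.sphere (0 : V) 1 => ENNReal.ofReal (g v) := by fun_prop
  have hm2 : Measurable fun t : Ioi (0 : ℝ) => ENNReal.ofReal (t.1 * Real.exp (-t.1 ^ 2)) := by
    fun_prop
  rw [lintegral_prod_mul hm1.aemeasurable hm2.aemeasurable,
    lintegral_volumeIoiPow _ (fun t => ENNReal.ofReal (t * Real.exp (-t ^ 2))) (by fun_prop)]
  congr 1
  -- Homogeneity adds one factor `t` to the polar weight `t ^ (n - 1)`.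
  have hint : ∫ t in Ioi (0:ℝ), t ^ n * Real.exp (-t ^ 2) = Real.Gamma ((n + 1 : ℝ) / 2) / 2 := by
    have := integral_rpow_mul_exp_neg_rpow (p := 2) (q := n) (by norm_num)
      (by have : (0:ℝ) ≤ n := by positivity
          linarith)
    simp only [Real.rpow_natCast, Real.rpow_ofNat] at this
    rw [this]; ring
  have hG : 0 < Real.Gamma ((n + 1 : ℝ) / 2) := Real.Gamma_pos_of_pos (by positivity)
  rw [← hint, ofReal_integral_eq_lintegral_ofReal]
  · refine setLIntegral_congr_fun measurableSet_Ioi fun t ht => ?_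
    have ht' : 0 < t := ht
    rw [← ENNReal.ofReal_mul (by positivity)]
    congr 1
    rw [← mul_assoc, ← pow_succ, Nat.sub_add_cancel hn]
  · apply Integrable.of_integral_ne_zero
    rw [hint]; positivity
  · filter_upwards [ae_restrict_mem measurableSet_Ioi] with t ht
    have ht' : 0 < t := ht
    change (0:ℝ) ≤ _
    positivity

theorem lintegral_gaussian :
    ∫⁻ x : V, ENNReal.ofReal (Real.exp (-‖x‖ ^ 2)) =
      ENNReal.ofReal (√Real.pi ^ Module.finrank ℝ V) := by
  have h := GaussianFourier.integral_rexp_neg_mul_sq_norm (V := V) (b := 1) one_pos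
  have h' : ∫ x : V, Real.exp (-‖x‖ ^ 2) = √Real.pi ^ Module.finrank ℝ V := by
    simp only [neg_mul, one_mul, div_one] at h
    rw [h, Real.sqrt_eq_rpow, ← Real.rpow_natCast, ← Real.rpow_mul Real.pi_pos.le]
    congr 1; ring
  rw [← h', ofReal_integral_eq_lintegral_ofReal]
  · apply Integrable.of_integral_ne_zero
    rw [h']
    positivity
  · exact Filter.Eventually.of_forall fun x => (Real.exp_pos _).le

theorem toSphere_univ_eq [Nontrivial V] : (volume : Measure V).toSphere univ =
    ENNReal.ofReal (Module.finrank ℝ V * kappa (Module.finrank ℝ V)) := by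
  rw [Measure.toSphere_apply_univ, InnerProductSpace.volume_ball, ← kappa_eq,
    ENNReal.ofReal_mul (by positivity), ENNReal.ofReal_natCast]
  simp

theorem gamma_half_eq {j : ℕ} (hj : 0 < j) :
    Real.Gamma ((j + 1 : ℝ) / 2) = √Real.pi ^ (j - 1) / kappa (j - 1) := by
  rw [kappa_eq]
  obtain ⟨j, rfl⟩ := Nat.exists_eq_add_of_lt hj
  have : 0 < Real.Gamma ((j : ℝ) / 2 + 1) := Real.Gamma_pos_of_pos (by positivity)
  have hp : 0 < √Real.pi := by positivity
  simp only [zero_add, Nat.add_sub_cancel]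
  rw [div_div_cancel₀ (by positivity)]
  congr 1; push_cast; ring

/-- Evaluate the integral of `‖proj_W x‖ exp(-‖x‖²)` in two ways: in polar coordinates on `V`, and
by Fubini on `W × Wᗮ`, where the `W` factor is again polar and the `Wᗮ` factor is a plain Gaussian.
The powers of `√π` cancel. -/
theorem lintegral_toSphere_norm_proj [Nontrivial V] (W : Submodule ℝ V)
    (hW : 0 < Module.finrank ℝ W) :
    ∫⁻ v, ENNReal.ofReal ‖W.orthogonalProjectionOnto (v : V)‖ ∂(volume : Measure V).toSphere =
      ENNReal.ofReal (kappa (Module.finrank ℝ V - 1) * (Module.finrank ℝ W *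
        kappa (Module.finrank ℝ W) / kappa (Module.finrank ℝ W - 1))) := by
  have hV : 0 < Module.finrank ℝ V := Module.finrank_pos
  have hadd := W.finrank_add_finrank_orthogonal
  set n := Module.finrank ℝ V
  set j := Module.finrank ℝ W with hj
  set l := Module.finrank ℝ Wᗮ with hl
  have : Nontrivial W := Module.nontrivial_of_finrank_pos hW
  have e1 := lintegral_gaussian_homogeneous (V := V) (fun x => ‖W.orthogonalProjectionOnto x‖)
    (by fun_prop) (fun _ => norm_nonneg _)
    (fun t x ht => by simp [norm_smul, abs_of_pos ht])
  have e2 := lintegral_gaussian_homogeneous (V := W) (fun x => ‖x‖)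
    (by fun_prop) (fun _ => norm_nonneg _)
    (fun t x ht => by simp [norm_smul, abs_of_pos ht])
  have e3 := lintegral_gaussian (V := Wᗮ)
  have e4 : ∫⁻ x : V, ENNReal.ofReal (‖W.orthogonalProjectionOnto x‖ * Real.exp (-‖x‖ ^ 2)) =
      (∫⁻ x : W, ENNReal.ofReal (‖x‖ * Real.exp (-‖x‖ ^ 2))) *
        ∫⁻ x : Wᗮ, ENNReal.ofReal (Real.exp (-‖x‖ ^ 2)) := by
    have hmp := W.measurePreserving_measurableEquivProd (0 : V)
    rw [InnerProductSpace.euclideanHausdorffMeasure_eq_volume] at hmp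
    rw [← lintegral_prod_mul (by fun_prop) (by fun_prop), ← Measure.volume_eq_prod,
      ← hmp.lintegral_comp_emb (MeasurableEquiv.measurableEmbedding _)]
    refine lintegral_congr fun x => ?_
    rw [← ENNReal.ofReal_mul (by positivity)]
    congr 1
    simp only [Submodule.measurableEquivProd_apply, vsub_eq_sub, sub_zero]
    rw [mul_assoc, ← Real.exp_add]
    congr 2
    have := W.norm_sq_eq_add_norm_sq_projection x
    rw [this]
    simp only [Submodule.orthogonalProjectionOnto_apply_eq_projectionOnto]
    ring
  rw [e4, e2, e3] at e1
  simp only [norm_eq_of_mem_sphere, ENNReal.ofReal_one, lintegral_one] at e1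
  rw [toSphere_univ_eq, gamma_half_eq hV] at e1
  rw [← hj, ← hl, gamma_half_eq hW] at e1
  have k1 := kappa_pos j
  have k2 := kappa_pos (j - 1)
  have k3 := kappa_pos (n - 1)
  have hp : 0 < √Real.pi := by positivity
  have hX : (0:ℝ) < √Real.pi ^ (n - 1) / kappa (n - 1) / 2 := by positivity
  rw [← ENNReal.ofReal_mul (by positivity), ← ENNReal.ofReal_mul (by positivity)] at e1
  have hX' := (ENNReal.ofReal_pos.2 hX).ne'
  rw [← ENNReal.mul_left_inj hX' ENNReal.ofReal_ne_top, ← e1, ← ENNReal.ofReal_mul (by positivity)]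
  congr 1
  have hpow : √Real.pi ^ (n - 1) = √Real.pi ^ (j - 1) * √Real.pi ^ l := by
    rw [← pow_add]; congr 1; omega
  rw [hpow]
  field_simp

/-- Surface measure is cone volume up to a factor, and the cone stays inside the Lebesgue-null
subspace `U`. -/
theorem toSphere_submodule_eq_zero [Nontrivial V] (U : Submodule ℝ V) (hU : U ≠ ⊤) :
    (volume : Measure V).toSphere {v | (v : V) ∈ U} = 0 := by
  have hm : MeasurableSet {v : Metric.sphere (0 : V) 1 | (v : V) ∈ U} :=
    measurable_subtype_coe (U.closed_of_finiteDimensional.measurableSet)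
  rw [Measure.toSphere_apply' _ hm]
  have : (volume : Measure V) (Ioo (0:ℝ) 1 • (Subtype.val '' {v : Metric.sphere (0 : V) 1 | (v : V) ∈ U}))
      = 0 := by
    refine measure_mono_null ?_ (Measure.addHaar_submodule volume U hU)
    rintro _ ⟨t, -, _, ⟨v, hv, rfl⟩, rfl⟩
    exact U.smul_mem t hv
  rw [this, mul_zero]

theorem map_neg_toSphere : (volume : Measure V).toSphere.map (fun v => -v) =
    (volume : Measure V).toSphere := by
  have hn : Measurable (fun v : Metric.sphere (0 : V) 1 => -v) := continuous_neg.measurable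
  ext A hA
  rw [Measure.map_apply hn hA, Measure.toSphere_apply' _ hA, Measure.toSphere_apply' _ (hn hA)]
  congr 1
  rw [← Measure.measure_neg]
  congr 1
  ext x
  simp only [Set.mem_neg, mem_smul]
  constructor
  · rintro ⟨t, ht, _, ⟨v, hv, rfl⟩, h⟩
    exact ⟨t, ht, _, ⟨-v, hv, rfl⟩, by simp [h]⟩
  · rintro ⟨t, ht, _, ⟨v, hv, rfl⟩, h⟩
    exact ⟨t, ht, _, ⟨-v, by simpa using hv, rfl⟩, by simp [h]⟩

end Polar

/-! ### The uniform distribution on the hemisphere -/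

section Hemisphere

variable {d : ℕ}

theorem measurableSet_upperHemisphere (d : ℕ) : MeasurableSet (upperHemisphere d) := by
  have : upperHemisphere d = ⋂ i : Fin d, ⋂ _ : i.val + 1 = d,
      {v : Metric.sphere (0 : E d) 1 | 0 ≤ (v : E d) i} := by
    ext v; simp [upperHemisphere]
  rw [this]
  refine MeasurableSet.iInter fun i => MeasurableSet.iInter fun _ => ?_
  apply measurableSet_le <;> fun_prop

theorem toSphere_coord_eq_zero (i : Fin d) :
    (volume : Measure (E d)).toSphere {v : Metric.sphere (0 : E d) 1 | (v : E d) i = 0} = 0 := by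
  have : Nonempty (Fin d) := ⟨i⟩
  have := toSphere_submodule_eq_zero (V := E d) (LinearMap.ker (EuclideanSpace.proj (𝕜 := ℝ) i).toLinearMap)
    (by
      intro h
      have : EuclideanSpace.single i (1:ℝ) ∈ LinearMap.ker (EuclideanSpace.proj (𝕜 := ℝ) i).toLinearMap := by
        rw [h]; trivial
      simp at this)
  simpa using this

theorem lintegral_toSphere_even (hd : 0 < d) (f : Metric.sphere (0 : E d) 1 → ℝ≥0∞)
    (hf : Measurable f) (hev : ∀ v, f (-v) = f v) :
    ∫⁻ v, f v ∂(volume : Measure (E d)).toSphere =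
      2 * ∫⁻ v in upperHemisphere d, f v ∂(volume : Measure (E d)).toSphere := by
  set σ : Measure (Metric.sphere (0 : E d) 1) := (volume : Measure (E d)).toSphere with hσ
  have hn : Measurable (fun v : Metric.sphere (0 : E d) 1 => -v) := continuous_neg.measurable
  set i : Fin d := ⟨d - 1, by omega⟩
  have hU : ∀ v, v ∈ upperHemisphere d ↔ 0 ≤ (v : E d) i := by
    intro v
    refine ⟨fun h => h i (by simp only [i]; omega), fun h j hj => ?_⟩
    have : j = i := by ext; simp [i]; omega
    rwa [this]
  -- The two sides differ only on the equator, which is null.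
  have h1 : (upperHemisphere d)ᶜ =ᵐ[σ] (fun v => -v) ⁻¹' upperHemisphere d := by
    have h0 : ∀ᵐ v : Metric.sphere (0 : E d) 1 ∂σ, (v : E d) i ≠ 0 := by
      rw [ae_iff]; simpa using toSphere_coord_eq_zero i
    filter_upwards [h0] with v hv
    apply propext
    change ¬ (v ∈ upperHemisphere d) ↔ -v ∈ upperHemisphere d
    rw [hU, hU]
    simp only [not_le]
    change _ ↔ 0 ≤ (-(v : E d)) i
    simp only [PiLp.neg_apply]
    constructor
    · intro h; linarith
    · intro h
      rcases lt_or_eq_of_le h with h | h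
      · linarith
      · exact absurd (by linarith) hv
  rw [← lintegral_add_compl f (measurableSet_upperHemisphere d),
    setLIntegral_congr (s := (upperHemisphere d)ᶜ) h1, two_mul]
  congr 1
  conv_rhs => rw [hσ, ← map_neg_toSphere]
  rw [setLIntegral_map (measurableSet_upperHemisphere d) hf hn]
  simp_rw [hev]
  rfl

theorem lintegral_uniformHemisphere (f : Metric.sphere (0 : E d) 1 → ℝ≥0∞) :
    ∫⁻ v, f v ∂(uniformHemisphere d) =
      ((volume : Measure (E d)).toSphere (upperHemisphere d))⁻¹ *
        ∫⁻ v in upperHemisphere d, f v ∂(volume : Measure (E d)).toSphere := by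
  rw [uniformHemisphere, lintegral_subtype_comap (measurableSet_upperHemisphere d),
    Measure.restrict_smul, lintegral_smul_measure, smul_eq_mul]

theorem two_mul_toSphere_upperHemisphere (hd : 0 < d) :
    2 * (volume : Measure (E d)).toSphere (upperHemisphere d) = ENNReal.ofReal (d * kappa d) := by
  have : Nonempty (Fin d) := ⟨⟨0, hd⟩⟩
  have h := lintegral_toSphere_even hd (fun _ => 1) measurable_const (fun _ => rfl)
  simp only [lintegral_one, Measure.restrict_apply_univ] at h
  rw [toSphere_univ_eq] at h
  simpa using h.symm

theorem lintegral_uniformHemisphere_even (hd : 0 < d) (f : Metric.sphere (0 : E d) 1 → ℝ≥0∞)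
    (hf : Measurable f) (hev : ∀ v, f (-v) = f v) :
    ∫⁻ v, f v ∂(uniformHemisphere d) =
      (ENNReal.ofReal (d * kappa d))⁻¹ * ∫⁻ v, f v ∂(volume : Measure (E d)).toSphere := by
  rw [lintegral_uniformHemisphere, lintegral_toSphere_even hd f hf hev,
    ← two_mul_toSphere_upperHemisphere hd, ENNReal.mul_inv (by simp) (by simp), ← mul_assoc,
    mul_right_comm _ _ (2 : ℝ≥0∞), ENNReal.inv_mul_cancel (by simp) (by simp), one_mul]

theorem isProbabilityMeasure_uniformHemisphere (hd : 0 < d) :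
    IsProbabilityMeasure (uniformHemisphere d) := by
  have : Nonempty (Fin d) := ⟨⟨0, hd⟩⟩
  constructor
  have h := lintegral_uniformHemisphere_even hd (fun _ => 1) measurable_const (fun _ => rfl)
  simp only [lintegral_one] at h
  have hk := kappa_pos d
  rw [h, toSphere_univ_eq, finrank_euclideanSpace_fin]
  exact ENNReal.inv_mul_cancel (ENNReal.ofReal_pos.2 (by positivity)).ne' ENNReal.ofReal_ne_top

/-- The mean length of the projection of a uniform unit vector of `ℝ^d` to a `j`-dimensional
linear subspace. -/
noncomputable def meanProj (d j : ℕ) : ℝ :=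
  kappa (d - 1) / (d * kappa d) * (j * kappa j / kappa (j - 1))

theorem meanProj_nonneg (d j : ℕ) : 0 ≤ meanProj d j := by
  have := kappa_pos (d - 1); have := kappa_pos d; have := kappa_pos j; have := kappa_pos (j - 1)
  unfold meanProj; positivity

theorem lintegral_norm_proj (hd : 0 < d) (W : Submodule ℝ (E d)) (hW : 0 < Module.finrank ℝ W) :
    ∫⁻ v, ENNReal.ofReal ‖W.orthogonalProjectionOnto (v : E d)‖ ∂(uniformHemisphere d) =
      ENNReal.ofReal (meanProj d (Module.finrank ℝ W)) := by
  have : Nonempty (Fin d) := ⟨⟨0, hd⟩⟩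
  have hk := kappa_pos d
  rw [lintegral_uniformHemisphere_even hd
      (fun v => ENNReal.ofReal ‖W.orthogonalProjectionOnto (v : E d)‖) (by fun_prop) (fun v => by simp),
    lintegral_toSphere_norm_proj W hW, ← ENNReal.ofReal_inv_of_pos (by positivity),
    ← ENNReal.ofReal_mul (by positivity), meanProj, finrank_euclideanSpace_fin]
  congr 1
  ring

/-- The source of every general-position statement about random normals. -/
theorem uniformHemisphere_submodule (hd : 0 < d) (U : Submodule ℝ (E d)) (hU : U ≠ ⊤) :
    ∀ᵐ v : upperHemisphere d ∂(uniformHemisphere d), ((v : Metric.sphere (0 : E d) 1) : E d) ∉ U := by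
  have : Nonempty (Fin d) := ⟨⟨0, hd⟩⟩
  rw [ae_iff]
  simp only [not_not]
  have hm : MeasurableSet {v : Metric.sphere (0 : E d) 1 | (v : E d) ∈ U} :=
    measurable_subtype_coe (U.closed_of_finiteDimensional.measurableSet)
  have h := lintegral_uniformHemisphere
    (indicator {v : Metric.sphere (0 : E d) 1 | (v : E d) ∈ U} 1)
  have h0 : ∫⁻ v in upperHemisphere d, indicator {v : Metric.sphere (0 : E d) 1 | (v : E d) ∈ U} 1 v
      ∂(volume : Measure (E d)).toSphere = 0 := by
    rw [lintegral_indicator_one hm]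
    exact measure_mono_null (Set.Subset.refl _) (Measure.absolutelyContinuous_of_le
      Measure.restrict_le_self (toSphere_submodule_eq_zero U hU))
  rw [h0, mul_zero] at h
  have hm' : MeasurableSet {v : upperHemisphere d | ((v : Metric.sphere (0 : E d) 1) : E d) ∈ U} :=
    measurable_subtype_coe hm
  rw [← lintegral_indicator_one hm', ← h]
  rfl

end Hemisphere

end PoissonHyperplane

/-! ### Cutting a flat by one hyperplane -/

namespace PoissonHyperplane

variable {d : ℕ}

/-- The unit normal of the hyperplane with parameters `x`. -/
abbrev normal (x : Param d) : E d := ((x.2 : Metric.sphere (0 : E d) 1) : E d)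

theorem norm_normal (x : Param d) : ‖normal x‖ = 1 := norm_eq_of_mem_sphere _

theorem mem_hyperplane {x : Param d} {y : E d} : y ∈ hyperplane x ↔ inner ℝ y (normal x) = x.1 :=
  Iff.rfl

theorem exists_foot (S : AffineSubspace ℝ (E d)) (hS : (S : Set (E d)).Nonempty) :
    ∃ c ∈ S, ∀ w ∈ S.direction, inner ℝ c w = 0 := by
  obtain ⟨y, hy⟩ := hS
  refine ⟨y - S.direction.starProjection y, ?_, fun w hw => ?_⟩
  · have := AffineSubspace.vadd_mem_of_mem_direction
      (S.direction.neg_mem (S.direction.starProjection_apply_mem y)) hy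
    simpa [sub_eq_add_neg, add_comm] using this
  · rw [real_inner_comm]
    exact (Submodule.sub_starProjection_mem_orthogonal (K := S.direction) y) w hw

theorem norm_sq_foot {S : AffineSubspace ℝ (E d)} {c y : E d} (hc : c ∈ S) (hy : y ∈ S)
    (h : ∀ w ∈ S.direction, inner ℝ c w = 0) : ‖y‖ ^ 2 = ‖c‖ ^ 2 + ‖y - c‖ ^ 2 := by
  have h0 : inner ℝ c (y - c) = 0 := h _ (by simpa using AffineSubspace.vsub_mem_direction hy hc)
  have := norm_add_sq_real c (y - c)
  rw [h0] at this
  simpa using this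

theorem infEDist_foot {S : AffineSubspace ℝ (E d)} {c : E d} (hc : c ∈ S)
    (h : ∀ w ∈ S.direction, inner ℝ c w = 0) : Metric.infEDist 0 (S : Set (E d)) = ‖c‖ₑ := by
  apply le_antisymm
  · refine (Metric.infEDist_le_edist_of_mem hc).trans_eq ?_
    rw [edist_comm, edist_zero_right]
  · rw [Metric.le_infEDist]
    intro y hy
    rw [edist_comm, edist_zero_right, enorm_le_iff_norm_le, ← sq_le_sq₀ (norm_nonneg _) (norm_nonneg _),
      norm_sq_foot hc hy h]
    nlinarith [sq_nonneg ‖y - c‖]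

theorem direction_hyperplane (x : Param d) {w : E d} :
    w ∈ (hyperplane x).direction ↔ inner ℝ w (normal x) = 0 := by
  have hmem : (x.1 • normal x) ∈ hyperplane x := by
    rw [mem_hyperplane, real_inner_smul_left, real_inner_self_eq_norm_sq, norm_normal]; simp
  rw [← AffineSubspace.vadd_mem_iff_mem_direction _ hmem, mem_hyperplane, vadd_eq_add,
    inner_add_left, mem_hyperplane.1 hmem]
  simp

theorem hyperplane_foot (x : Param d) :
    Metric.infEDist 0 (hyperplane x : Set (E d)) = ‖x.1‖ₑ := by
  have hmem : (x.1 • normal x) ∈ hyperplane x := by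
    rw [mem_hyperplane, real_inner_smul_left, real_inner_self_eq_norm_sq, norm_normal]; simp
  rw [infEDist_foot hmem]
  · rw [enorm_smul, ← ofReal_norm (normal x), norm_normal]; simp
  · intro w hw
    rw [direction_hyperplane, real_inner_comm] at hw
    rw [real_inner_smul_left, hw, mul_zero]

/-- On `W` the functional `⟨·, v⟩` is represented by the projection of `v`, so `D` is the kernel of
a nonzero functional on `W`. -/
theorem finrank_inf_orthogonal {W : Submodule ℝ (E d)} {v : E d}
    (hu : W.orthogonalProjectionOnto v ≠ 0) {D : Submodule ℝ (E d)}
    (hD : ∀ w, w ∈ D ↔ w ∈ W ∧ inner ℝ w v = 0) :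
    Module.finrank ℝ D + 1 = Module.finrank ℝ W := by
  set u := W.orthogonalProjectionOnto v
  have hne : (innerSL ℝ u : W →L[ℝ] ℝ).toLinearMap ≠ 0 := by
    intro h
    have : (innerSL ℝ u : W →L[ℝ] ℝ).toLinearMap u = 0 := by rw [h]; rfl
    simp at this
    exact hu this
  rw [← Module.Dual.finrank_ker_add_one_of_ne_zero (f := (innerSL ℝ u : W →L[ℝ] ℝ).toLinearMap) hne]
  congr 1
  have : D = (LinearMap.ker (innerSL ℝ u : W →L[ℝ] ℝ).toLinearMap).map W.subtype := by
    ext w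
    rw [hD]
    simp only [Submodule.mem_map, LinearMap.mem_ker, ContinuousLinearMap.coe_coe, innerSL_apply_apply,
      Submodule.subtype_apply]
    constructor
    · rintro ⟨h1, h2⟩
      refine ⟨⟨w, h1⟩, ?_, rfl⟩
      rw [Submodule.inner_orthogonalProjectionOnto_eq_of_mem_right, real_inner_comm]
      exact h2
    · rintro ⟨w, h, rfl⟩
      refine ⟨w.2, ?_⟩
      rw [Submodule.inner_orthogonalProjectionOnto_eq_of_mem_right, real_inner_comm] at h
      exact h
  rw [this, Submodule.finrank_map_subtype_eq]

/-- Intersecting a flat with a hyperplane in general position: the new foot of the perpendicular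
from the origin, and the dimension. -/
theorem inf_hyperplane {S : AffineSubspace ℝ (E d)} {c : E d} (hc : c ∈ S)
    (h : ∀ w ∈ S.direction, inner ℝ c w = 0) (x : Param d)
    (hu : S.direction.orthogonalProjectionOnto (normal x) ≠ 0) :
    ((S ⊓ hyperplane x : AffineSubspace ℝ (E d)) : Set (E d)).Nonempty ∧
    Module.finrank ℝ (S ⊓ hyperplane x).direction + 1 = Module.finrank ℝ S.direction ∧
    Metric.infEDist 0 ((S ⊓ hyperplane x : AffineSubspace ℝ (E d)) : Set (E d)) =
      ENNReal.ofReal √(‖c‖ ^ 2 + ((x.1 - inner ℝ c (normal x)) /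
        ‖S.direction.orthogonalProjectionOnto (normal x)‖) ^ 2) := by
  set W := S.direction
  set u := W.orthogonalProjectionOnto (normal x)
  have hu' : ‖u‖ ≠ 0 := norm_ne_zero_iff.2 hu
  -- The new foot lies on the line from `c` along `u`; as `⟨u, v⟩ = ‖u‖²`, this `t` puts `c + t • u`
  -- on the hyperplane.
  set t := (x.1 - inner ℝ c (normal x)) / ‖u‖ ^ 2
  have huv : inner ℝ (u : E d) (normal x) = ‖u‖ ^ 2 := by
    rw [real_inner_comm, ← Submodule.inner_orthogonalProjectionOnto_eq_of_mem_right,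
      real_inner_self_eq_norm_sq]
  have h1 : c + t • (u : E d) ∈ S := by
    have := AffineSubspace.vadd_mem_of_mem_direction (W.smul_mem t u.2) hc
    rwa [vadd_eq_add, add_comm] at this
  have h2 : c + t • (u : E d) ∈ hyperplane x := by
    rw [mem_hyperplane, inner_add_left, real_inner_smul_left, huv]
    simp only [t]
    field_simp
    ring
  have hdir : ∀ w, w ∈ (S ⊓ hyperplane x).direction ↔ w ∈ W ∧ inner ℝ w (normal x) = 0 := by
    intro w
    rw [AffineSubspace.direction_inf_of_mem h1 h2, Submodule.mem_inf, direction_hyperplane]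
  refine ⟨⟨_, h1, h2⟩, finrank_inf_orthogonal hu hdir, ?_⟩
  rw [infEDist_foot (S := S ⊓ hyperplane x) (c := c + t • (u : E d)) ⟨h1, h2⟩]
  · rw [← ofReal_norm]
    congr 1
    symm
    rw [Real.sqrt_eq_iff_mul_self_eq (by positivity) (norm_nonneg _), ← sq, norm_add_sq_real,
      real_inner_smul_right, h _ u.2, norm_smul, mul_pow, Submodule.coe_norm]
    simp only [t, Real.norm_eq_abs, sq_abs, Submodule.coe_norm] at hu' ⊢
    field_simp
    ring
  · intro w hw
    obtain ⟨hw1, hw2⟩ := (hdir w).1 hw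
    rw [inner_add_left, real_inner_smul_left, h _ hw1]
    have := Submodule.inner_orthogonalProjectionOnto_eq_of_mem_right (K := W) ⟨w, hw1⟩ (normal x)
    rw [Submodule.coe_inner] at this
    change inner ℝ (u : E d) w = _ at this
    rw [this, real_inner_comm]
    simp [hw2]

theorem lintegral_comp_affine {F : ℝ → ℝ≥0∞} (hF : Measurable F) (a : ℝ) {b : ℝ} (hb : 0 < b) :
    ∫⁻ p : ℝ, F ((p - a) / b) = ENNReal.ofReal b * ∫⁻ q, F q := by
  rw [lintegral_sub_right_eq_self (fun p => F (p / b)) a]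
  have h := Real.map_volume_mul_left (a := b⁻¹) (inv_ne_zero hb.ne')
  simp_rw [div_eq_inv_mul]
  rw [← lintegral_map (f := F) hF (by fun_prop), h, lintegral_smul_measure]
  simp [abs_of_pos hb]

/-- An empty intersection is at distance `⊤`, so it contributes nothing. -/
theorem sectionVolume_top (n : ℕ) (r : ℝ) : sectionVolume n r ⊤ = 0 := by
  simp [sectionVolume]

/-- Pythagoras: a flat at distance `a` meets the ball in a ball of radius `√(r² - a²)`, inside which
the next cut has distance `|q|` from the centre. -/
theorem sectionVolume_sqrt_add {n : ℕ} {r a : ℝ} (hr : 0 ≤ r) (ha : 0 ≤ a) (har : a ≤ r) (q : ℝ) :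
    sectionVolume n r (ENNReal.ofReal √(a ^ 2 + q ^ 2)) = sectionVolume n √(r ^ 2 - a ^ 2) ‖q‖ₑ := by
  have h0 : 0 ≤ r ^ 2 - a ^ 2 := by nlinarith
  have hiff : ENNReal.ofReal √(a ^ 2 + q ^ 2) ≤ ENNReal.ofReal r ↔
      ‖q‖ₑ ≤ ENNReal.ofReal √(r ^ 2 - a ^ 2) := by
    rw [ENNReal.ofReal_le_ofReal_iff hr, ← ofReal_norm, ENNReal.ofReal_le_ofReal_iff (by positivity),
      Real.sqrt_le_left hr, Real.le_sqrt (norm_nonneg _) h0, Real.norm_eq_abs, sq_abs]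
    constructor <;> intro <;> linarith
  unfold sectionVolume
  simp only [hiff]
  congr 4
  rw [ENNReal.toReal_ofReal (by positivity), Real.sq_sqrt (by positivity), toReal_enorm,
    Real.norm_eq_abs, sq_abs, Real.sq_sqrt h0, sub_sub]

/-- Crofton formula for a fixed normal: the change of variable `q = (p - ⟨c, v⟩) / ‖u‖` produces the
factor `‖u‖`, and Cavalieri inside `S` raises the dimension. -/
theorem lintegral_sectionVolume_inf_hyperplane (n : ℕ) {r : ℝ} (hr : 0 ≤ r)
    (S : AffineSubspace ℝ (E d)) (hS : (S : Set (E d)).Nonempty) (v : upperHemisphere d) :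
    ∫⁻ p : ℝ, sectionVolume n r (Metric.infEDist 0
        ((S ⊓ hyperplane (p, v) : AffineSubspace ℝ (E d)) : Set (E d))) =
      ENNReal.ofReal ‖S.direction.orthogonalProjectionOnto ((v : Metric.sphere (0 : E d) 1) : E d)‖ *
        sectionVolume (n + 1) r (Metric.infEDist 0 (S : Set (E d))) := by
  obtain ⟨c, hc, h⟩ := exists_foot S hS
  by_cases hu : S.direction.orthogonalProjectionOnto ((v : Metric.sphere (0 : E d) 1) : E d) = 0
  · rw [hu, norm_zero, ENNReal.ofReal_zero, zero_mul]
    -- If `v` is orthogonal to `S`, the hyperplane misses `S` except for this single `p`.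
    have h0 : ∀ᵐ p : ℝ, p ≠ inner ℝ c ((v : Metric.sphere (0 : E d) 1) : E d) := by
      simp [ae_iff]
    rw [lintegral_congr_ae (g := fun _ => 0), lintegral_zero]
    filter_upwards [h0] with p hp
    have : ((S ⊓ hyperplane (p, v) : AffineSubspace ℝ (E d)) : Set (E d)) = ∅ := by
      rw [Set.eq_empty_iff_forall_notMem]
      rintro y ⟨hy1, hy2⟩
      apply hp
      have e1 : inner ℝ y ((v : Metric.sphere (0 : E d) 1) : E d) = p := hy2
      have e2 : y - c ∈ S.direction := by simpa using AffineSubspace.vsub_mem_direction hy1 hc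
      have e3 := Submodule.inner_orthogonalProjectionOnto_eq_of_mem_right
        (K := S.direction) ⟨y - c, e2⟩ ((v : Metric.sphere (0 : E d) 1) : E d)
      rw [hu, inner_zero_left, real_inner_comm, inner_sub_left, e1] at e3
      linarith
    rw [this, Metric.infEDist_empty, sectionVolume_top]
  · have hpos : 0 < ‖S.direction.orthogonalProjectionOnto ((v : Metric.sphere (0 : E d) 1) : E d)‖ :=
      norm_pos_iff.2 hu
    simp_rw [fun p : ℝ => (inf_hyperplane hc h (p, v) hu).2.2]
    change ∫⁻ p : ℝ, sectionVolume n r (ENNReal.ofReal √(‖c‖ ^ 2 +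
      ((p - inner ℝ c ((v : Metric.sphere (0 : E d) 1) : E d)) /
        ‖S.direction.orthogonalProjectionOnto ((v : Metric.sphere (0 : E d) 1) : E d)‖) ^ 2)) = _
    rw [lintegral_comp_affine (F := fun q => sectionVolume n r (ENNReal.ofReal √(‖c‖ ^ 2 + q ^ 2)))
      ((measurable_sectionVolume n r).comp (by fun_prop)) _ hpos, infEDist_foot hc h]
    congr 1
    by_cases hcr : ‖c‖ ≤ r
    · simp_rw [sectionVolume_sqrt_add hr (norm_nonneg c) hcr]
      rw [lintegral_sectionVolume _ (Real.sqrt_nonneg _), sectionVolume, if_pos]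
      · simp
      · rw [← ofReal_norm]; exact ENNReal.ofReal_le_ofReal hcr
    · have hz : ∀ q : ℝ, sectionVolume n r (ENNReal.ofReal √(‖c‖ ^ 2 + q ^ 2)) = 0 := by
        intro q
        rw [sectionVolume, if_neg]
        rw [ENNReal.ofReal_le_ofReal_iff hr, Real.sqrt_le_left hr]
        push Not at hcr ⊢
        nlinarith [sq_nonneg q]
      simp_rw [hz]
      rw [lintegral_zero, sectionVolume, if_neg]
      rw [← ofReal_norm, ENNReal.ofReal_le_ofReal_iff hr]
      exact hcr

/-- The distance is attained at the foot; `s ≠ ⊤` excludes the empty flat. -/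
theorem infEDist_le_iff (S : AffineSubspace ℝ (E d)) {s : ℝ≥0∞} (hs : s ≠ ⊤) :
    Metric.infEDist 0 (S : Set (E d)) ≤ s ↔ ∃ y ∈ S, ‖y‖ₑ ≤ s := by
  constructor
  · intro h
    rcases (S : Set (E d)).eq_empty_or_nonempty with he | hne
    · rw [he, Metric.infEDist_empty] at h
      exact absurd (top_le_iff.1 h) hs
    · obtain ⟨c, hc, hcS⟩ := exists_foot S hne
      exact ⟨c, hc, by rwa [infEDist_foot hc hcS] at h⟩
  · rintro ⟨y, hy, hys⟩
    refine (Metric.infEDist_le_edist_of_mem hy).trans ?_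
    rwa [edist_comm, edist_zero_right]

/-- Sublevel sets are closed, being projections of a closed incidence set along a compact ball. -/
theorem measurable_infEDist_iInf {ι : Type*} [Fintype ι] (S : AffineSubspace ℝ (E d)) :
    Measurable fun x : ι → Param d => Metric.infEDist 0
      ((S ⊓ ⨅ i, hyperplane (x i) : AffineSubspace ℝ (E d)) : Set (E d)) := by
  refine measurable_of_Iic fun s => ?_
  by_cases hs : s = ⊤
  · simp [hs]
  apply IsClosed.measurableSet
  have hcomp : CompactSpace (Metric.closedBall (0 : E d) s.toReal) :=
    isCompact_iff_compactSpace.1 (isCompact_closedBall _ _)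
  let Z : Set ((ι → Param d) × Metric.closedBall (0 : E d) s.toReal) :=
    {z | (z.2 : E d) ∈ (S : Set (E d))} ∩ ⋂ i, {z | inner ℝ (z.2 : E d) (normal (z.1 i)) = (z.1 i).1}
  have hZ : IsClosed Z := by
    refine IsClosed.inter ?_ (isClosed_iInter fun i => ?_)
    · exact (AffineSubspace.closed_of_finiteDimensional S).preimage (by fun_prop)
    · exact isClosed_eq (by fun_prop) (by fun_prop)
  convert isClosedMap_fst_of_compactSpace Z hZ using 1
  ext x
  simp only [mem_preimage, mem_Iic, infEDist_le_iff _ hs, mem_image, Prod.exists, exists_and_right,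
    exists_eq_right]
  constructor
  · rintro ⟨y, ⟨hy1, hy2⟩, hys⟩
    refine ⟨⟨y, ?_⟩, hy1, ?_⟩
    · rw [mem_closedBall_zero_iff, ← toReal_enorm]
      exact ENNReal.toReal_mono hs hys
    · rw [mem_iInter]
      intro i
      exact (AffineSubspace.mem_iInf_iff _ _).1 hy2 i
  · rintro ⟨⟨y, hys⟩, hy1, hy2⟩
    rw [mem_iInter] at hy2
    refine ⟨y, ⟨hy1, (AffineSubspace.mem_iInf_iff _ _).2 fun i => hy2 i⟩, ?_⟩
    rw [mem_closedBall_zero_iff] at hys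
    rw [← ofReal_norm]
    exact ENNReal.ofReal_le_of_le_toReal hys

end PoissonHyperplane

/-! ### Iterated cuts by random hyperplanes -/

namespace PoissonHyperplane

variable {d : ℕ}

/-- The flat cut out of `S` by the hyperplanes with parameters `x`. -/
noncomputable abbrev cut {ι : Type*} (S : AffineSubspace ℝ (E d)) (x : ι → Param d) :
    AffineSubspace ℝ (E d) := S ⊓ ⨅ i, hyperplane (x i)

/-- The distance from the origin to the flat cut out of `S` by the hyperplanes `x`. -/
noncomputable abbrev cutDist {ι : Type*} (S : AffineSubspace ℝ (E d)) (x : ι → Param d) : ℝ≥0∞ :=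
  Metric.infEDist 0 (cut S x : Set (E d))

theorem cut_succ {m : ℕ} (S : AffineSubspace ℝ (E d)) (x : Fin (m + 1) → Param d) :
    cut S x = cut (S ⊓ hyperplane (x 0)) (fun i : Fin m => x i.succ) := by
  ext y
  simp only [cut, AffineSubspace.mem_inf_iff, AffineSubspace.mem_iInf_iff, Fin.forall_fin_succ]
  tauto

theorem abs_le_of_mem_hyperplane {x : Param d} {y : E d} (hy : y ∈ hyperplane x) :
    |x.1| ≤ ‖y‖ := by
  have := abs_real_inner_le_norm y (normal x)
  rwa [mem_hyperplane.1 hy, norm_normal, mul_one] at this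

theorem measurable_infEDist_inf_hyperplane (S : AffineSubspace ℝ (E d)) :
    Measurable fun x : Param d => Metric.infEDist 0
      ((S ⊓ hyperplane x : AffineSubspace ℝ (E d)) : Set (E d)) := by
  have h := (measurable_infEDist_iInf (ι := Unit) S).comp
    (measurable_pi_lambda (fun x : Param d => fun _ : Unit => x) fun _ => measurable_id)
  simpa only [Function.comp_def, iInf_const] using h

/-- Hyperplanes with `|p| > r` miss the ball, so only `τ` on `[-r, r]` matters. This covers both the
uniform law on `[-r, r]` and `λ dp` on the line. -/
theorem lintegral_sectionVolume_param (hd : 0 < d) (n : ℕ) {r : ℝ} (hr : 0 ≤ r) {τ : Measure ℝ}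
    [SFinite τ] {c : ℝ≥0∞} (hτ : τ.restrict (Icc (-r) r) = c • volume.restrict (Icc (-r) r))
    (S : AffineSubspace ℝ (E d)) (hS : (S : Set (E d)).Nonempty)
    (hdim : 0 < Module.finrank ℝ S.direction) :
    ∫⁻ x, sectionVolume n r (Metric.infEDist 0 ((S ⊓ hyperplane x : AffineSubspace ℝ (E d)) :
      Set (E d))) ∂(τ.prod (uniformHemisphere d)) =
      c * ENNReal.ofReal (meanProj d (Module.finrank ℝ S.direction)) *
        sectionVolume (n + 1) r (Metric.infEDist 0 (S : Set (E d))) := by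
  have := isProbabilityMeasure_uniformHemisphere hd
  have hmeas := (measurable_sectionVolume n r).comp (measurable_infEDist_inf_hyperplane S)
  rw [lintegral_prod_symm' _ (by exact hmeas)]
  have hin : ∀ v : upperHemisphere d, ∫⁻ p, sectionVolume n r (Metric.infEDist 0
      ((S ⊓ hyperplane (p, v) : AffineSubspace ℝ (E d)) : Set (E d))) ∂τ =
      c * (ENNReal.ofReal ‖S.direction.orthogonalProjectionOnto
        ((v : Metric.sphere (0 : E d) 1) : E d)‖ *
        sectionVolume (n + 1) r (Metric.infEDist 0 (S : Set (E d)))) := by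
    intro v
    rw [← lintegral_sectionVolume_inf_hyperplane n hr S hS v]
    have hz : Function.support (fun p : ℝ => sectionVolume n r (Metric.infEDist 0
        ((S ⊓ hyperplane (p, v) : AffineSubspace ℝ (E d)) : Set (E d)))) ⊆ Icc (-r) r := by
      intro p hp
      by_contra hpr
      apply hp
      simp only [sectionVolume]
      rw [if_neg]
      rw [infEDist_le_iff _ ENNReal.ofReal_ne_top]
      rintro ⟨y, hy, hyr⟩
      rw [← ofReal_norm, ENNReal.ofReal_le_ofReal_iff hr] at hyr
      exact hpr (abs_le.1 ((abs_le_of_mem_hyperplane hy.2).trans hyr))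
    rw [← setLIntegral_eq_of_support_subset hz,
      ← setLIntegral_eq_of_support_subset (μ := volume) hz, hτ, lintegral_smul_measure, smul_eq_mul]
  simp_rw [hin]
  rw [lintegral_const_mul _ (by fun_prop), lintegral_mul_const _ (by fun_prop),
    lintegral_norm_proj hd _ hdim, mul_assoc]

/-- Iterated intersection with random hyperplanes. -/
theorem lintegral_sectionVolume_cut (hd : 0 < d) {r : ℝ} (hr : 0 ≤ r) {τ : Measure ℝ}
    [SigmaFinite τ] {c : ℝ≥0∞} (hτ : τ.restrict (Icc (-r) r) = c • volume.restrict (Icc (-r) r))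
    (m n : ℕ) (S : AffineSubspace ℝ (E d)) (hS : (S : Set (E d)).Nonempty)
    (hdim : m ≤ Module.finrank ℝ S.direction) :
    ∫⁻ x : Fin m → Param d, sectionVolume n r (cutDist S x)
      ∂(Measure.pi fun _ => τ.prod (uniformHemisphere d)) =
      c ^ m * (∏ i ∈ Finset.range m,
        ENNReal.ofReal (meanProj d (Module.finrank ℝ S.direction - i))) *
        sectionVolume (n + m) r (Metric.infEDist 0 (S : Set (E d))) := by
  have := isProbabilityMeasure_uniformHemisphere hd
  induction m generalizing S with
  | zero =>
    rw [Measure.pi_of_empty, lintegral_dirac]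
    simp [cutDist, cut]
  | succ m ih =>
    have hmp := measurePreserving_piFinSuccAbove
      (fun _ : Fin (m + 1) => τ.prod (uniformHemisphere d)) 0
    have hmeas : Measurable fun x : Fin (m + 1) → Param d => sectionVolume n r (cutDist S x) :=
      (measurable_sectionVolume n r).comp (measurable_infEDist_iInf S)
    rw [← hmp.symm.lintegral_comp_emb (MeasurableEquiv.measurableEmbedding _),
      lintegral_prod]
    swap
    · exact (hmeas.comp (MeasurableEquiv.measurable _)).aemeasurable
    -- Almost every cut is transversal and lowers the dimension by exactly one.
    have hae : ∀ᵐ x : Param d ∂(τ.prod (uniformHemisphere d)),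
        S.direction.orthogonalProjectionOnto (normal x) ≠ 0 := by
      have hne : S.directionᗮ ≠ ⊤ := by
        intro h
        rw [Submodule.orthogonal_eq_top_iff] at h
        rw [h] at hdim
        simp at hdim
      have h1 := uniformHemisphere_submodule hd S.directionᗮ hne
      filter_upwards [Measure.quasiMeasurePreserving_snd.ae h1] with x hx h0
      exact hx (Submodule.orthogonalProjectionOnto_eq_zero_iff.1 h0)
    obtain ⟨a, ha, haS⟩ := exists_foot S hS
    have hstep : ∀ᵐ x : Param d ∂(τ.prod (uniformHemisphere d)),
        ∫⁻ y : Fin m → Param d, sectionVolume n r (cutDist S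
          ((MeasurableEquiv.piFinSuccAbove (fun _ : Fin (m + 1) => Param d) 0).symm (x, y)))
          ∂(Measure.pi fun _ => τ.prod (uniformHemisphere d)) =
        (c ^ m * (∏ i ∈ Finset.range m,
          ENNReal.ofReal (meanProj d (Module.finrank ℝ S.direction - (i + 1))))) *
          sectionVolume (n + m) r (Metric.infEDist 0
            ((S ⊓ hyperplane x : AffineSubspace ℝ (E d)) : Set (E d))) := by
      filter_upwards [hae] with x hx
      obtain ⟨h1, h2, -⟩ := inf_hyperplane ha haS x hx
      have h3 := ih (S ⊓ hyperplane x) h1 (by omega)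
      -- The drop in dimension shifts the index of the product by one; the factor `i = 0` comes from
      -- the first cut.
      have h4 : ∀ i, Module.finrank ℝ (S ⊓ hyperplane x).direction - i =
          Module.finrank ℝ S.direction - (i + 1) := fun i => by omega
      simp_rw [h4] at h3
      rw [← h3]
      refine lintegral_congr fun y => ?_
      rw [cutDist, cut_succ]
      rfl
    rw [lintegral_congr_ae hstep, lintegral_const_mul]
    · rw [lintegral_sectionVolume_param hd _ hr hτ S hS (by omega), Finset.prod_range_succ',
        pow_succ, add_assoc]
      simp only [Nat.sub_zero]
      ring
    · exact (measurable_sectionVolume (n + m) r).comp (measurable_infEDist_inf_hyperplane S)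

/-- The factors `j κ_j / κ_{j-1}` telescope. -/
theorem prod_meanProj (hd : 0 < d) {k : ℕ} (hk : k < d) :
    ∏ i ∈ Finset.range (d - k), meanProj d (d - i) =
      (kappa (d - 1) / (d * kappa d)) ^ (d - k) * ((d ! : ℝ) * kappa d / ((k ! : ℝ) * kappa k)) := by
  have key : ∀ m, m ≤ d → ∏ i ∈ Finset.range m, meanProj d (d - i) =
      (kappa (d - 1) / (d * kappa d)) ^ m *
        ((d ! : ℝ) * kappa d / (((d - m)! : ℝ) * kappa (d - m))) := by
    intro m
    induction m with
    | zero =>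
      intro _
      have := kappa_pos d
      simp only [Finset.range_zero, Finset.prod_empty, pow_zero, Nat.sub_zero, one_mul]
      rw [div_self (by positivity)]
    | succ m ih =>
      intro hm
      rw [Finset.prod_range_succ, ih (by omega), meanProj]
      obtain ⟨l, hl⟩ : ∃ l, d - m = l + 1 := ⟨d - m - 1, by omega⟩
      rw [show d - (m + 1) = l by omega, hl, Nat.factorial_succ, Nat.add_sub_cancel, pow_succ]
      have h1 := kappa_pos l
      have h2 := kappa_pos (l + 1)
      have h3 : (0:ℝ) < (l ! : ℝ) := by positivity
      push_cast
      field_simp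
  rw [key _ (Nat.sub_le _ _), Nat.sub_sub_self hk.le]

/-- Since `meanProj d d = 1`, starting from a hyperplane instead of the whole space leaves the
product unchanged. -/
theorem prod_meanProj_pred (hd : 0 < d) {k : ℕ} (hk : k < d) :
    ∏ i ∈ Finset.range (d - k - 1), meanProj d (d - 1 - i) =
      (kappa (d - 1) / (d * kappa d)) ^ (d - k) * ((d ! : ℝ) * kappa d / ((k ! : ℝ) * kappa k)) := by
  rw [← prod_meanProj hd hk]
  obtain ⟨l, hl⟩ : ∃ l, d - k = l + 1 := ⟨d - k - 1, by omega⟩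
  rw [hl, Finset.prod_range_succ', Nat.add_sub_cancel]
  have h1 : meanProj d (d - 0) = 1 := by
    have h2 := kappa_pos d
    have h3 := kappa_pos (d - 1)
    have h4 : (0:ℝ) < d := by exact_mod_cast hd
    rw [meanProj, Nat.sub_zero]
    field_simp
  rw [h1, mul_one]
  exact Finset.prod_congr rfl fun i _ => by congr 1; omega

/-! ### General position -/

theorem ae_linearIndependent_normal (hd : 0 < d) {τ : Measure ℝ} [SigmaFinite τ] (m : ℕ)
    (hm : m ≤ d) : ∀ᵐ x : Fin m → Param d ∂(Measure.pi fun _ => τ.prod (uniformHemisphere d)),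
      LinearIndependent ℝ fun i => normal (x i) := by
  have := isProbabilityMeasure_uniformHemisphere hd
  induction m with
  | zero => exact Filter.Eventually.of_forall fun x => linearIndependent_empty_type
  | succ m ih =>
    have hmp := measurePreserving_piFinSuccAbove
      (fun _ : Fin (m + 1) => τ.prod (uniformHemisphere d)) 0
    have hms : MeasurableSet {p : Param d × (Fin m → Param d) | LinearIndependent ℝ
        (Fin.cons (normal p.1) fun i => normal (p.2 i) : Fin (m + 1) → E d)} := by
      have hcont : Continuous fun p : Param d × (Fin m → Param d) =>
          (Fin.cons (normal p.1) fun i => normal (p.2 i) : Fin (m + 1) → E d) := by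
        refine continuous_pi fun i => ?_
        refine Fin.cases ?_ (fun j => ?_) i <;> simp only [Fin.cons_zero, Fin.cons_succ] <;> fun_prop
      exact (isOpen_setOfPred_linearIndependent.preimage hcont).measurableSet
    have h : ∀ᵐ p : Param d × (Fin m → Param d) ∂((τ.prod (uniformHemisphere d)).prod
        (Measure.pi fun _ => τ.prod (uniformHemisphere d))), LinearIndependent ℝ
        (Fin.cons (normal p.1) fun i => normal (p.2 i) : Fin (m + 1) → E d) := by
      -- The order is exchanged so that the other normals are fixed before the new one avoids their
      -- span, which is proper as `m < d`.
      rw [Measure.ae_prod_iff_ae_ae hms, Measure.ae_ae_comm (p := fun (a : Param d)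
        (b : Fin m → Param d) => LinearIndependent ℝ
          (Fin.cons (normal a) fun i => normal (b i) : Fin (m + 1) → E d)) hms]
      filter_upwards [ih (by omega)] with y hy
      have hne : Submodule.span ℝ (range fun i => normal (y i)) ≠ ⊤ := by
        intro h
        have h1 := finrank_span_eq_card hy
        rw [h, finrank_top, finrank_euclideanSpace_fin, Fintype.card_fin] at h1
        omega
      filter_upwards [Measure.quasiMeasurePreserving_snd.ae
        (uniformHemisphere_submodule hd _ hne)] with x hx
      exact linearIndependent_finCons.2 ⟨hy, hx⟩
    filter_upwards [hmp.quasiMeasurePreserving.ae h] with x hx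
    convert hx using 1
    funext i
    refine Fin.cases ?_ (fun j => ?_) i <;> rfl

/-- The map `y ↦ (⟨v_i, y⟩)_i` has kernel of dimension `d - m`, hence is onto `ℝ^m`, and the cut is
one of its fibres. -/
theorem cut_top_of_linearIndependent {m : ℕ} {x : Fin m → Param d}
    (h : LinearIndependent ℝ fun i => normal (x i)) :
    (cut ⊤ x : Set (E d)).Nonempty ∧ Module.finrank ℝ (cut ⊤ x).direction = d - m := by
  let T : E d →ₗ[ℝ] (Fin m → ℝ) := LinearMap.pi fun i => (innerSL ℝ (normal (x i))).toLinearMap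
  have hT : ∀ y i, T y i = inner ℝ (normal (x i)) y := fun y i => rfl
  have hker : LinearMap.ker T = (Submodule.span ℝ (range fun i => normal (x i)))ᗮ := by
    ext y
    rw [LinearMap.mem_ker, Submodule.mem_orthogonal]
    constructor
    · intro hy u hu
      induction hu using Submodule.span_induction with
      | mem u hu => obtain ⟨i, rfl⟩ := hu; rw [← hT, hy]; rfl
      | zero => simp
      | add u v _ _ hu hv => rw [inner_add_left, hu, hv, add_zero]
      | smul a u _ hu => rw [inner_smul_left, hu, mul_zero]
    · intro hy
      funext i
      rw [hT]
      exact hy _ (Submodule.subset_span ⟨i, rfl⟩)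
  have hspan := finrank_span_eq_card h
  rw [Fintype.card_fin] at hspan
  have horth := (Submodule.span ℝ (range fun i => normal (x i))).finrank_add_finrank_orthogonal
  rw [hspan, ← hker, finrank_euclideanSpace_fin] at horth
  have hrk := T.finrank_range_add_finrank_ker
  rw [finrank_euclideanSpace_fin] at hrk
  have htop : LinearMap.range T = ⊤ := by
    apply Submodule.eq_top_of_finrank_eq
    rw [Module.finrank_fintype_fun_eq_card, Fintype.card_fin]
    omega
  obtain ⟨y, hy⟩ := LinearMap.range_eq_top.1 htop fun i => (x i).1
  have hmem : ∀ z, z ∈ cut ⊤ x ↔ T z = T y := by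
    intro z
    rw [hy, cut, top_inf_eq, AffineSubspace.mem_iInf_iff, funext_iff]
    refine forall_congr' fun i => ?_
    rw [mem_hyperplane, hT, real_inner_comm]
  have hyc : y ∈ cut ⊤ x := (hmem y).2 rfl
  refine ⟨⟨y, hyc⟩, ?_⟩
  have hdir : (cut ⊤ x).direction = LinearMap.ker T := by
    ext w
    rw [← AffineSubspace.vadd_mem_iff_mem_direction _ hyc, hmem, vadd_eq_add, map_add,
      LinearMap.mem_ker]
    simp
  rw [hdir]
  omega

/-! ### Volume and Euler characteristic of sections of the ball -/

theorem inter_originBall_nonempty_iff (S : AffineSubspace ℝ (E d)) (r : ℝ) (hr : 0 ≤ r) :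
    ((S : Set (E d)) ∩ originBall d r).Nonempty ↔
      Metric.infEDist 0 (S : Set (E d)) ≤ ENNReal.ofReal r := by
  rw [infEDist_le_iff _ ENNReal.ofReal_ne_top]
  refine exists_congr fun y => and_congr Iff.rfl ?_
  rw [originBall, mem_closedBall_zero_iff, ← ofReal_norm, ENNReal.ofReal_le_ofReal_iff hr]

theorem chi_inter_originBall (S : AffineSubspace ℝ (E d)) {r : ℝ} (hr : 0 ≤ r) :
    chi ((S : Set (E d)) ∩ originBall d r) =
      sectionVolume 0 r (Metric.infEDist 0 (S : Set (E d))) := by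
  simp only [chi, sectionVolume, inter_originBall_nonempty_iff S r hr, kappa_zero]
  simp

/-- An isometry of `ℝ^k` onto `S` taking `0` to the foot carries the ball of radius `√(r² - ‖c‖²)`
onto the section, and Hausdorff measure is preserved. -/
theorem nu_inter_originBall {k : ℕ} (S : AffineSubspace ℝ (E d)) (hS : (S : Set (E d)).Nonempty)
    (hk : Module.finrank ℝ S.direction = k) {r : ℝ} (hr : 0 ≤ r) :
    nu d k ((S : Set (E d)) ∩ originBall d r) =
      sectionVolume k r (Metric.infEDist 0 (S : Set (E d))) := by
  by_cases hne : ((S : Set (E d)) ∩ originBall d r).Nonempty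
  · have hle := (inter_originBall_nonempty_iff S r hr).1 hne
    rw [sectionVolume, if_pos hle]
    obtain ⟨c, hc, h⟩ := exists_foot S hS
    rw [infEDist_foot hc h] at hle ⊢
    rw [← ofReal_norm, ENNReal.ofReal_le_ofReal_iff hr] at hle
    rw [toReal_enorm, ← volume_closedBall_zero k (Real.sqrt_nonneg _),
      ← EuclideanSpace.euclideanHausdorffMeasure_eq_volume, nu]
    let L := ((stdOrthonormalBasis ℝ S.direction).reindex (finCongr hk)).repr.symm
    have hiso : Isometry fun y : E k => c + (L y : E d) :=
      (IsometryEquiv.addLeft c).isometry.comp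
        (S.direction.subtypeₗᵢ.isometry.comp L.isometry)
    rw [← hiso.euclideanHausdorffMeasure_image]
    congr 1
    have h0 : 0 ≤ r ^ 2 - ‖c‖ ^ 2 := by nlinarith [norm_nonneg c]
    have key : ∀ y ∈ S, (y ∈ originBall d r ↔ ‖y - c‖ ≤ √(r ^ 2 - ‖c‖ ^ 2)) := by
      intro y hy
      rw [originBall, mem_closedBall_zero_iff, Real.le_sqrt (norm_nonneg _) h0,
        ← sq_le_sq₀ (norm_nonneg _) hr, norm_sq_foot hc hy h]
      constructor <;> intro <;> linarith
    ext y
    simp only [mem_inter_iff, mem_image, mem_closedBall_zero_iff]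
    constructor
    · rintro ⟨hy, hyr⟩
      have hw : y - c ∈ S.direction := by simpa using AffineSubspace.vsub_mem_direction hy hc
      refine ⟨L.symm ⟨y - c, hw⟩, ?_, by simp⟩
      rw [LinearIsometryEquiv.norm_map]
      exact (key y hy).1 hyr
    · rintro ⟨z, hz, rfl⟩
      have hy : c + (L z : E d) ∈ S := by
        have := AffineSubspace.vadd_mem_of_mem_direction (L z).2 hc
        rwa [vadd_eq_add, add_comm] at this
      refine ⟨hy, (key _ hy).2 ?_⟩
      rw [add_sub_cancel_left]
      exact (L.norm_map z).le.trans hz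
  · have hle := fun h => hne ((inter_originBall_nonempty_iff S r hr).2 h)
    rw [sectionVolume, if_neg hle, Set.not_nonempty_iff_eq_empty.1 hne, measure_empty]

end PoissonHyperplane

/-! ### Second moments: two sections sharing a hyperplane -/

namespace PoissonHyperplane

variable {d : ℕ}

theorem cut_cons {l : ℕ} (a : Param d) (y : Fin l → Param d) :
    cut ⊤ (Fin.cons a y : Fin (l + 1) → Param d) = cut (hyperplane a) y := by
  rw [cut_succ]; simp

theorem measurable_cutDist_hyperplane (l : ℕ) :
    Measurable fun p : Param d × (Fin l → Param d) => cutDist (hyperplane p.1) p.2 := by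
  have h : Measurable fun p : Param d × (Fin l → Param d) =>
      (Fin.cons p.1 p.2 : Fin (l + 1) → Param d) :=
    measurable_pi_lambda _ fun i => by
      refine Fin.cases ?_ (fun j => ?_) i <;> simp only [Fin.cons_zero, Fin.cons_succ] <;> fun_prop
  have h2 := (measurable_infEDist_iInf (ι := Fin (l + 1)) (⊤ : AffineSubspace ℝ (E d))).comp h
  simpa only [Function.comp_def, cut_cons] using h2

/-- The index of the hyperplane shared by the two sections. -/
def midIdx (l : ℕ) : Fin (2 * (l + 1) - 1) := ⟨l, by omega⟩

/-- The indices of the hyperplanes occurring only in the first section. -/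
def leftIdx (l : ℕ) (i : Fin l) : Fin (2 * (l + 1) - 1) := ⟨i, by omega⟩

/-- The indices of the hyperplanes occurring only in the second section. -/
def rightIdx (l : ℕ) (i : Fin l) : Fin (2 * (l + 1) - 1) := ⟨l + 1 + i, by omega⟩

theorem firstSection_eq (l : ℕ) (r : ℝ) (x : Fin (2 * (l + 1) - 1) → Param d) :
    firstSection (l + 1) r x =
      (cut (hyperplane (x (midIdx l))) (fun i => x (leftIdx l i)) : Set (E d)) ∩ originBall d r := by
  ext y
  simp only [firstSection, cut, mem_ofPred_eq, mem_inter_iff, SetLike.mem_coe,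
    AffineSubspace.mem_inf_iff, AffineSubspace.mem_iInf_iff]
  refine and_congr_left fun _ => ⟨fun h => ⟨h _ (by simp [midIdx]), fun i => h _ ?_⟩, ?_⟩
  · simp only [leftIdx]; omega
  · rintro ⟨h1, h2⟩ i hi
    rcases Nat.lt_succ_iff_lt_or_eq.1 hi with h | h
    · exact h2 ⟨i, h⟩
    · have : i = midIdx l := Fin.ext h
      rwa [this]

theorem secondSection_eq (l : ℕ) (r : ℝ) (x : Fin (2 * (l + 1) - 1) → Param d) :
    secondSection (l + 1) r x =
      (cut (hyperplane (x (midIdx l))) (fun i => x (rightIdx l i)) : Set (E d)) ∩ originBall d r := by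
  ext y
  simp only [secondSection, cut, mem_ofPred_eq, mem_inter_iff, SetLike.mem_coe,
    AffineSubspace.mem_inf_iff, AffineSubspace.mem_iInf_iff]
  refine and_congr_left fun _ => ⟨fun h => ⟨h _ (by simp [midIdx]), fun i => h _ ?_⟩, ?_⟩
  · simp only [rightIdx]; omega
  · rintro ⟨h1, h2⟩ i hi
    rcases Nat.lt_or_ge l i.val with h | h
    · have : i = rightIdx l ⟨i - (l + 1), by omega⟩ := Fin.ext (by simp only [rightIdx]; omega)
      rw [this]
      exact h2 _
    · have : i = midIdx l := Fin.ext (by simp only [midIdx]; omega)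
      rwa [this]

theorem measurePreserving_split (l : ℕ) (μ : Measure (Param d)) [SigmaFinite μ] :
    MeasurePreserving (fun x : Fin (2 * (l + 1) - 1) → Param d =>
      (x (midIdx l), ((fun i => x (leftIdx l i)), fun i => x (rightIdx l i))))
      (Measure.pi fun _ => μ)
      (μ.prod ((Measure.pi fun _ => μ).prod (Measure.pi fun _ => μ))) := by
  let f : Unit ⊕ (Fin l ⊕ Fin l) → Fin (2 * (l + 1) - 1) :=
    Sum.elim (fun _ => midIdx l) (Sum.elim (leftIdx l) (rightIdx l))
  have hf : Function.Bijective f := by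
    rw [Fintype.bijective_iff_injective_and_card]
    constructor
    · rintro (a | a | a) (b | b | b) h <;>
        simp only [f, Sum.elim_inl, Sum.elim_inr, midIdx, leftIdx, rightIdx, Fin.mk.injEq] at h
      all_goals first | rfl | omega | skip
      · simp [Fin.ext_iff, h]
      · simp only [Sum.inr.injEq, Fin.ext_iff]; omega
    · simp only [Fintype.card_sum, Fintype.card_fin, Fintype.card_unit]; omega
  let e : Unit ⊕ (Fin l ⊕ Fin l) ≃ Fin (2 * (l + 1) - 1) := Equiv.ofBijective f hf
  have h1 := (measurePreserving_piCongrLeft (fun _ : Fin (2 * (l + 1) - 1) => μ) e).symm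
  have h2 := measurePreserving_sumPiEquivProdPi (fun _ : Unit ⊕ (Fin l ⊕ Fin l) => μ)
  have h3 := measurePreserving_sumPiEquivProdPi (fun _ : Fin l ⊕ Fin l => μ)
  have h4 := measurePreserving_funUnique μ Unit
  exact ((h4.prod h3).comp h2).comp h1

/-- Given the shared coordinate, the left and right blocks are independent copies, so the product
integrates to a square. -/
theorem lintegral_split_sq (l : ℕ) (μ : Measure (Param d)) [SigmaFinite μ]
    (f : Param d → (Fin l → Param d) → ℝ≥0∞)
    (hf : Measurable fun p : Param d × (Fin l → Param d) => f p.1 p.2) :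
    ∫⁻ x : Fin (2 * (l + 1) - 1) → Param d, f (x (midIdx l)) (fun i => x (leftIdx l i)) *
      f (x (midIdx l)) (fun i => x (rightIdx l i)) ∂(Measure.pi fun _ => μ) =
    ∫⁻ a, (∫⁻ y, f a y ∂(Measure.pi fun _ => μ)) ^ 2 ∂μ := by
  have hF : Measurable fun z : Param d × ((Fin l → Param d) × (Fin l → Param d)) =>
      f z.1 z.2.1 * f z.1 z.2.2 := by
    refine Measurable.mul ?_ ?_
    · exact hf.comp (measurable_fst.prodMk (measurable_fst.comp measurable_snd))
    · exact hf.comp (measurable_fst.prodMk (measurable_snd.comp measurable_snd))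
  have h1 := (measurePreserving_split l μ).lintegral_comp hF
  refine h1.trans ?_
  rw [lintegral_prod _ hF.aemeasurable]
  refine lintegral_congr fun a => ?_
  have hm : AEMeasurable (f a) (Measure.pi fun _ : Fin l => μ) :=
    (hf.comp measurable_prodMk_left).aemeasurable
  rw [sq]
  exact lintegral_prod_mul hm hm

/-- Here `d - k = l + 1`; `n = 0` serves `χ` and `n = k` serves `ν_k`. Each of the `2l + 1`
hyperplanes contributes one density `(2r)⁻¹`. -/
theorem lintegral_two_sections (hd : 0 < d) {r : ℝ} (hr : 0 < r) (l n : ℕ) (hl : l < d) :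
    ∫⁻ x : Fin (2 * (l + 1) - 1) → Param d,
      sectionVolume n r (cutDist (hyperplane (x (midIdx l))) fun i => x (leftIdx l i)) *
      sectionVolume n r (cutDist (hyperplane (x (midIdx l))) fun i => x (rightIdx l i))
      ∂(Measure.pi fun _ => sampleLaw r (uniformHemisphere d)) =
    ENNReal.ofReal ((2 * r)⁻¹ ^ (2 * l + 1) * (∏ i ∈ Finset.range l, meanProj d (d - 1 - i)) ^ 2 *
      (kappa (n + l) ^ 2 * (2 ^ (2 * (n + l) + 1) * ((n + l)! : ℝ) ^ 2 / ((2 * (n + l) + 1)! : ℝ)) *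
        r ^ (2 * (n + l) + 1))) := by
  have := isProbabilityMeasure_uniformHemisphere hd
  set c : ℝ≥0∞ := (ENNReal.ofReal (2 * r))⁻¹ with hc
  have hcr : c = ENNReal.ofReal (2 * r)⁻¹ := by
    rw [hc, ENNReal.ofReal_inv_of_pos (by positivity)]
  set τ : Measure ℝ := c • (volume : Measure ℝ).restrict (Icc (-r) r) with hτd
  have hfin : IsFiniteMeasure τ := by
    rw [hτd, hcr]; exact Measure.smul_finite _ ENNReal.ofReal_ne_top
  have hτ : τ.restrict (Icc (-r) r) = c • volume.restrict (Icc (-r) r) := by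
    rw [hτd, Measure.restrict_smul, Measure.restrict_restrict measurableSet_Icc, Set.inter_self]
  have hlaw : sampleLaw r (uniformHemisphere d) = τ.prod (uniformHemisphere d) := rfl
  rw [hlaw]
  set μ := τ.prod (uniformHemisphere d) with hμ
  have hfm : Measurable fun p : Param d × (Fin l → Param d) =>
      sectionVolume n r (cutDist (hyperplane p.1) p.2) :=
    (measurable_sectionVolume n r).comp (measurable_cutDist_hyperplane l)
  rw [lintegral_split_sq l μ (fun a y => sectionVolume n r (cutDist (hyperplane a) y)) hfm]
  have hrank : ∀ a : Param d, Module.finrank ℝ (hyperplane a).direction = d - 1 := by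
    intro a
    have h0 := inf_hyperplane (S := ⊤) (c := 0) trivial (fun w _ => inner_zero_left _) a (by
      intro h
      have h' := Submodule.orthogonalProjectionOnto_eq_zero_iff.1 h
      rw [AffineSubspace.direction_top, Submodule.top_orthogonal_eq_bot, Submodule.mem_bot] at h'
      have := norm_normal a
      rw [h', norm_zero] at this
      exact zero_ne_one this)
    rw [top_inf_eq, AffineSubspace.direction_top, finrank_top, finrank_euclideanSpace_fin] at h0
    omega
  have hin : ∀ a : Param d, (∫⁻ y : Fin l → Param d, sectionVolume n r (cutDist (hyperplane a) y)
      ∂(Measure.pi fun _ => μ)) ^ 2 =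
      (c ^ l * ENNReal.ofReal (∏ i ∈ Finset.range l, meanProj d (d - 1 - i))) ^ 2 *
        sectionVolume (n + l) r ‖a.1‖ₑ ^ 2 := by
    intro a
    have h2 := lintegral_sectionVolume_cut hd hr.le hτ l n (hyperplane a)
      ⟨a.1 • normal a, by
        change a.1 • normal a ∈ hyperplane a
        rw [mem_hyperplane, real_inner_smul_left, real_inner_self_eq_norm_sq, norm_normal]; simp⟩
      (by rw [hrank]; omega)
    rw [hrank, hyperplane_foot, ← ENNReal.ofReal_prod_of_nonneg fun i _ => meanProj_nonneg _ _] at h2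
    rw [h2, mul_pow]
  simp_rw [hin]
  have hsm : Measurable fun p : ℝ => sectionVolume (n + l) r ‖p‖ₑ ^ 2 :=
    ((measurable_sectionVolume _ _).comp measurable_enorm).pow_const 2
  have hsm' : Measurable fun a : Param d => sectionVolume (n + l) r ‖a.1‖ₑ ^ 2 :=
    hsm.comp measurable_fst
  rw [lintegral_const_mul _ hsm', hμ, lintegral_prod _ hsm'.aemeasurable]
  simp only [lintegral_const, measure_univ, mul_one]
  have hz : Function.support (fun p : ℝ => sectionVolume (n + l) r ‖p‖ₑ ^ 2) ⊆ Icc (-r) r := by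
    intro p hp
    by_contra hpr
    apply hp
    simp only [sectionVolume]
    rw [if_neg, zero_pow two_ne_zero]
    rw [← ofReal_norm, ENNReal.ofReal_le_ofReal_iff hr.le]
    exact fun h => hpr (abs_le.1 h)
  rw [← setLIntegral_eq_of_support_subset hz, hτ, lintegral_smul_measure,
    setLIntegral_eq_of_support_subset hz, lintegral_sectionVolume_sq _ hr.le, hcr, smul_eq_mul]
  have hP : 0 ≤ ∏ i ∈ Finset.range l, meanProj d (d - 1 - i) :=
    Finset.prod_nonneg fun i _ => meanProj_nonneg _ _
  rw [← ENNReal.ofReal_pow (by positivity), ← ENNReal.ofReal_mul (by positivity),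
    ← ENNReal.ofReal_pow (by positivity), ← ENNReal.ofReal_mul (by positivity),
    ← ENNReal.ofReal_mul (by positivity)]
  congr 1
  ring

theorem sigmaChi_eq (k : ℕ) (hk : k < d) {r : ℝ} (hr : 0 < r) :
    sigmaChi k r (uniformHemisphere d) = ENNReal.ofReal
      ((kappa (d - k - 1) * ((d - k - 1)! : ℝ)) ^ 2 / ((2 * d - 2 * k - 1)! : ℝ) *
        (((d)! : ℝ) * kappa d / (((k)! : ℝ) * kappa k)) ^ 2 *
        (kappa (d - 1) / (d * kappa d)) ^ (2 * (d - k))) := by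
  have hd : 0 < d := by omega
  have hprod := prod_meanProj_pred hd hk
  obtain ⟨l, hl⟩ : ∃ l, d - k = l + 1 := ⟨d - k - 1, by omega⟩
  have h := lintegral_two_sections hd hr l 0 (by omega)
  rw [sigmaChi, hl]
  simp_rw [firstSection_eq, secondSection_eq, chi_inter_originBall _ hr.le]
  rw [h]
  rw [hl, Nat.add_sub_cancel] at hprod
  rw [hprod, Nat.add_sub_cancel, show 2 * d - 2 * k - 1 = 2 * l + 1 by omega]
  congr 1
  simp only [zero_add]
  rw [inv_pow, mul_pow 2 r, pow_mul' _ 2 (l + 1)]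
  field_simp

theorem sigmaNu_eq (k : ℕ) (hk : k < d) {r : ℝ} (hr : 0 < r) :
    sigmaNu k r (uniformHemisphere d) = ENNReal.ofReal
      ((2 ^ k * kappa (d - 1) * ((d - 1)! : ℝ)) ^ 2 / ((2 * d - 1)! : ℝ) *
        (((d)! : ℝ) * kappa d / (((k)! : ℝ) * kappa k)) ^ 2 *
        (kappa (d - 1) / (d * kappa d)) ^ (2 * (d - k))) := by
  have hd : 0 < d := by omega
  have hprod := prod_meanProj_pred hd hk
  obtain ⟨l, hl⟩ : ∃ l, d - k = l + 1 := ⟨d - k - 1, by omega⟩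
  have h := lintegral_two_sections hd hr l k (by omega)
  have hprob := isProbabilityMeasure_uniformHemisphere hd
  set c : ℝ≥0∞ := (ENNReal.ofReal (2 * r))⁻¹ with hc
  have hprobτ : IsProbabilityMeasure (c • (volume : Measure ℝ).restrict (Icc (-r) r)) := by
    constructor
    rw [Measure.smul_apply, Measure.restrict_apply_univ, Real.volume_Icc, hc, smul_eq_mul,
      sub_neg_eq_add, ← two_mul]
    exact ENNReal.inv_mul_cancel (ENNReal.ofReal_pos.2 (by positivity)).ne' ENNReal.ofReal_ne_top
  have hμ : IsProbabilityMeasure (sampleLaw r (uniformHemisphere d)) := by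
    unfold sampleLaw; infer_instance
  set μ := sampleLaw r (uniformHemisphere d)
  -- Unlike `χ`, the measure `ν_k` is identified with `sectionVolume k` only on flats of dimension
  -- exactly `k`, so general position is needed.
  have hgp : ∀ᵐ p : Param d × (Fin l → Param d) ∂(μ.prod (Measure.pi fun _ => μ)),
      nu d k ((cut (hyperplane p.1) p.2 : Set (E d)) ∩ originBall d r) =
        sectionVolume k r (cutDist (hyperplane p.1) p.2) := by
    have h1 := ae_linearIndependent_normal hd
      (τ := c • (volume : Measure ℝ).restrict (Icc (-r) r)) (l + 1) (by omega)
    have h2 := (measurePreserving_piFinSuccAbove (fun _ : Fin (l + 1) => μ) 0).symm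
    filter_upwards [h2.quasiMeasurePreserving.ae h1] with p hp
    obtain ⟨hne, hdim⟩ := cut_top_of_linearIndependent hp
    have e : ((MeasurableEquiv.piFinSuccAbove (fun _ : Fin (l + 1) => Param d) 0).symm p) =
        (Fin.cons p.1 p.2 : Fin (l + 1) → Param d) := by
      funext i
      refine Fin.cases ?_ (fun j => ?_) i <;> rfl
    rw [e, cut_cons] at hne hdim
    exact nu_inter_originBall _ hne (hdim.trans (by omega)) hr.le
  have hsplit := (measurePreserving_split l μ).quasiMeasurePreserving
  have hL := hsplit.ae (((MeasurePreserving.id μ).prod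
    (measurePreserving_fst (μ := Measure.pi fun _ : Fin l => μ)
      (ν := Measure.pi fun _ : Fin l => μ))).quasiMeasurePreserving.ae hgp)
  have hR := hsplit.ae (((MeasurePreserving.id μ).prod
    (measurePreserving_snd (μ := Measure.pi fun _ : Fin l => μ)
      (ν := Measure.pi fun _ : Fin l => μ))).quasiMeasurePreserving.ae hgp)
  rw [sigmaNu, hl]
  simp_rw [firstSection_eq, secondSection_eq]
  have hcongr := lintegral_congr_ae (μ := Measure.pi fun _ : Fin (2 * (l + 1) - 1) => μ) <| by
    filter_upwards [hL, hR] with x h1 h2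
    exact congrArg₂ (· * ·) h1 h2
  simp only [Prod.map, id] at hcongr
  rw [hcongr, h, ← ENNReal.ofReal_inv_of_pos (by positivity), ← ENNReal.ofReal_mul (by positivity)]
  rw [hl, Nat.add_sub_cancel] at hprod
  rw [hprod, show k + l = d - 1 by omega, show 2 * d - 1 = 2 * (d - 1) + 1 by omega]
  congr 1
  -- As `d - 1 = l + k`, the densities leave `(2 ^ k) ^ 2 * r ^ (2 * k)`, and the normalization
  -- removes the power of `r`.
  have e1 : (2 * r) ^ (2 * l + 1) * (2 ^ k) ^ 2 * r ^ (2 * k) =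
      2 ^ (2 * (d - 1) + 1) * r ^ (2 * (d - 1) + 1) := by
    rw [show 2 * (d - 1) + 1 = (2 * l + 1) + 2 * k by omega]
    ring
  have e2 : (2 * r)⁻¹ ^ (2 * l + 1) * (2 ^ (2 * (d - 1) + 1) * r ^ (2 * (d - 1) + 1)) =
      (2 ^ k) ^ 2 * r ^ (2 * k) := by
    rw [← e1, inv_pow]
    field_simp
  rw [pow_mul' _ 2 (l + 1)]
  calc _ = (r ^ (2 * k))⁻¹ *
        ((2 * r)⁻¹ ^ (2 * l + 1) * (2 ^ (2 * (d - 1) + 1) * r ^ (2 * (d - 1) + 1))) *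
        (((kappa (d - 1) / (d * kappa d)) ^ (l + 1) *
          ((d ! : ℝ) * kappa d / ((k ! : ℝ) * kappa k))) ^ 2 *
        (kappa (d - 1) ^ 2 * (((d - 1)! : ℝ) ^ 2 / ((2 * (d - 1) + 1)! : ℝ)))) := by ring
    _ = _ := by
      rw [e2]
      field_simp

end PoissonHyperplane

/-! ### Poisson counts and simplicity of the process -/

namespace PoissonHyperplane

section Counts

variable {Ω X : Type*} [MeasurableSpace Ω] [TopologicalSpace X] [MeasurableSpace X]
  {P : Measure Ω} [IsProbabilityMeasure P] {η : Ω → Measure X} {Λ : Measure X}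

theorem tsum_poissonMeasure (t : NNReal) : ∑' n : ℕ, poissonMeasure t {n} = 1 := by
  have h := lintegral_countable' (μ := poissonMeasure t) fun _ => 1
  simpa using h.symm

theorem tsum_mul_poissonMeasure (t : NNReal) :
    ∑' n : ℕ, (n : ℝ≥0∞) * poissonMeasure t {n} = t := by
  rw [tsum_eq_zero_add' ENNReal.summable]
  simp only [Nat.cast_zero, zero_mul, zero_add]
  have h2 : ∀ n : ℕ, ((n + 1 : ℕ) : ℝ≥0∞) * poissonMeasure t {n + 1} =
      t * poissonMeasure t {n} := by
    intro n
    rw [poissonMeasure_singleton, poissonMeasure_singleton, ← ENNReal.ofReal_natCast,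
      ← ENNReal.ofReal_mul (by positivity), ← ENNReal.ofReal_coe_nnreal,
      ← ENNReal.ofReal_mul (by positivity), Nat.factorial_succ]
    congr 1
    push_cast
    field_simp
    ring
  simp_rw [h2]
  rw [ENNReal.tsum_mul_left, tsum_poissonMeasure, mul_one]

/-- The Poisson weights sum to one, so an infinite count has probability zero and the mean is a sum
over `ℕ`. -/
theorem IsPoissonProcess.lintegral_apply (h : IsPoissonProcess P η Λ) {B : Set X}
    (hB : MeasurableSet B) (hfin : Λ B ≠ ∞) : ∫⁻ ω, η ω B ∂P = Λ B := by
  have hm := h.measurable B hB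
  have hset : ∀ n : ℕ, MeasurableSet {ω | η ω B = (n : ℝ≥0∞)} := fun n =>
    hm (measurableSet_singleton _)
  have hdisj : Pairwise (Function.onFun Disjoint fun n : ℕ => {ω | η ω B = (n : ℝ≥0∞)}) := by
    intro a b hab
    refine Set.disjoint_left.2 fun ω h1 h2 => hab ?_
    have : (a : ℝ≥0∞) = b := h1.symm.trans h2
    exact_mod_cast this
  have hU : P (⋃ n : ℕ, {ω | η ω B = (n : ℝ≥0∞)}) = 1 := by
    rw [measure_iUnion hdisj hset]
    simp_rw [fun n => h.poisson B hB hfin n]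
    exact tsum_poissonMeasure _
  have hae : ∀ᵐ ω ∂P, ω ∈ ⋃ n : ℕ, {ω | η ω B = (n : ℝ≥0∞)} := by
    rw [ae_iff]
    exact (prob_compl_eq_zero_iff (MeasurableSet.iUnion hset)).2 hU
  have hsum : ∀ᵐ ω ∂P, η ω B =
      ∑' n : ℕ, {ω | η ω B = (n : ℝ≥0∞)}.indicator (fun _ => (n : ℝ≥0∞)) ω := by
    filter_upwards [hae] with ω hω
    obtain ⟨n, hn⟩ := mem_iUnion.1 hω
    rw [tsum_eq_single n]
    · rw [indicator_of_mem hn]; exact hn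
    · intro b hb
      rw [indicator_of_notMem]
      intro hb'
      have : (b : ℝ≥0∞) = n := hb'.symm.trans hn
      exact hb (by exact_mod_cast this)
  rw [lintegral_congr_ae hsum, lintegral_tsum fun n =>
    (measurable_const.indicator (hset n)).aemeasurable]
  simp_rw [fun n => lintegral_indicator_const (μ := P) (hset n) (n : ℝ≥0∞),
    fun n => h.poisson B hB hfin n]
  rw [tsum_mul_poissonMeasure, ENNReal.coe_toNNReal hfin]

/-- From `exp(-t) ≥ 1 - t` follows `1 - exp(-t)(1 + t) ≤ t²`; a quadratic bound beats a number of
cells growing linearly in the mesh parameter. -/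
theorem IsPoissonProcess.prob_two_le (h : IsPoissonProcess P η Λ) {B : Set X}
    (hB : MeasurableSet B) (hfin : Λ B ≠ ∞) : P {ω | 2 ≤ η ω B} ≤ Λ B ^ 2 := by
  have hm := h.measurable B hB
  set t := (Λ B).toNNReal with ht
  have hΛ : Λ B = ENNReal.ofReal t := by
    rw [ENNReal.ofReal_coe_nnreal, ht, ENNReal.coe_toNNReal hfin]
  have hset : ∀ n : ℕ, MeasurableSet {ω | η ω B = (n : ℝ≥0∞)} := fun n =>
    hm (measurableSet_singleton _)
  have hsub : {ω | 2 ≤ η ω B} ⊆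
      ({ω | η ω B = ((0 : ℕ) : ℝ≥0∞)} ∪ {ω | η ω B = ((1 : ℕ) : ℝ≥0∞)})ᶜ := by
    rintro ω (hω : 2 ≤ η ω B) (h0 | h0)
    · rw [show η ω B = ((0 : ℕ) : ℝ≥0∞) from h0] at hω
      exact absurd hω (by norm_num)
    · rw [show η ω B = ((1 : ℕ) : ℝ≥0∞) from h0] at hω
      exact absurd hω (by norm_num)
  have hdisj : Disjoint {ω | η ω B = ((0 : ℕ) : ℝ≥0∞)} {ω | η ω B = ((1 : ℕ) : ℝ≥0∞)} := by
    refine Set.disjoint_left.2 fun ω h1 h2 => ?_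
    have := h1.symm.trans h2
    norm_num at this
  refine (measure_mono hsub).trans ?_
  rw [prob_compl_eq_one_sub ((hset 0).union (hset 1)), measure_union hdisj (hset 1),
    h.poisson B hB hfin 0, h.poisson B hB hfin 1, poissonMeasure_singleton, poissonMeasure_singleton,
    ← ht, hΛ, ← ENNReal.ofReal_pow (by positivity), ← ENNReal.ofReal_add (by positivity) (by positivity),
    ← ENNReal.ofReal_one, ← ENNReal.ofReal_sub _ (by positivity)]
  apply ENNReal.ofReal_le_ofReal
  have h1 : 1 - (t : ℝ) ≤ Real.exp (-t) := by
    have := Real.add_one_le_exp (-(t : ℝ)); linarith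
  have h2 : (0 : ℝ) ≤ t := t.2
  simp only [pow_zero, pow_one, Nat.factorial_zero, Nat.factorial_one, Nat.cast_one, mul_one,
    div_one]
  nlinarith

end Counts

theorem isCompact_upperHemisphere (d : ℕ) : CompactSpace (upperHemisphere d) := by
  rw [← isCompact_iff_compactSpace]
  apply IsClosed.isCompact
  have : upperHemisphere d = ⋂ i : Fin d, ⋂ _ : i.val + 1 = d,
      {v : Metric.sphere (0 : E d) 1 | 0 ≤ (v : E d) i} := by
    ext v; simp [upperHemisphere]
  rw [this]
  refine isClosed_iInter fun i => isClosed_iInter fun _ => ?_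
  exact isClosed_le (by fun_prop) (by fun_prop)

variable {d : ℕ}

/-- The slab of parameters with `⌊N p⌋ = j`. -/
def cell (d : ℕ) (N : ℕ) (j : ℤ) : Set (Param d) := {x | ⌊(N : ℝ) * x.1⌋ = j}

/-- The slab of parameters with `|p| ≤ M`. -/
def slab (d : ℕ) (M : ℕ) : Set (Param d) := {x | |x.1| ≤ M}

theorem measurableSet_cell (N : ℕ) (j : ℤ) : MeasurableSet (cell d N j) := by
  have : Measurable fun x : Param d => ⌊(N : ℝ) * x.1⌋ :=
    Int.measurable_floor.comp (by fun_prop)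
  exact this (measurableSet_singleton j)

theorem measurableSet_slab (M : ℕ) : MeasurableSet (slab d M) :=
  measurableSet_le (by fun_prop) (by fun_prop)

theorem measure_slab_lt_top (ψ : Measure (Param d)) [IsLocallyFiniteMeasure ψ] (M : ℕ) :
    ψ (slab d M) < ∞ := by
  have := isCompact_upperHemisphere d
  have hc : IsCompact (Icc (-(M : ℝ)) M ×ˢ (univ : Set (upperHemisphere d))) :=
    isCompact_Icc.prod isCompact_univ
  refine (measure_mono ?_).trans_lt hc.measure_lt_top
  intro x hx
  exact ⟨abs_le.1 hx, trivial⟩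

theorem cell_measure {Θ : Measure (upperHemisphere d)} [IsProbabilityMeasure Θ] {lam : ℝ}
    (hlam : 0 < lam) {N : ℕ} (hN : 0 < N) (j : ℤ) :
    (ENNReal.ofReal lam • (volume : Measure ℝ).prod Θ) (cell d N j) = ENNReal.ofReal (lam / N) := by
  have hN' : (0 : ℝ) < N := by exact_mod_cast hN
  have : cell d N j = Ico ((j : ℝ) / N) ((j + 1) / N) ×ˢ univ := by
    ext x
    simp only [cell, mem_ofPred_eq, Int.floor_eq_iff, mem_prod, mem_Ico, mem_univ, and_true,
      div_le_iff₀ hN', lt_div_iff₀ hN', mul_comm]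
  rw [this, Measure.smul_apply, Measure.prod_prod, measure_univ, mul_one, Real.volume_Ico,
    smul_eq_mul, ← ENNReal.ofReal_mul hlam.le]
  congr 1
  field_simp
  ring

section Moments

variable {Ω : Type*} [MeasurableSpace Ω] {P : Measure Ω} [IsProbabilityMeasure P]
  {η : Ω → Measure (Param d)} {Θ : Measure (upperHemisphere d)} [IsProbabilityMeasure Θ] {lam : ℝ}

/-- Almost surely, every bounded slab is covered by cells containing at most one point each. -/
theorem ae_cells_lt_two (hlam : 0 < lam)
    (h : IsPoissonProcess P η (ENNReal.ofReal lam • (volume : Measure ℝ).prod Θ)) :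
    ∀ᵐ ω ∂P, ∀ M : ℕ, ∃ N : ℕ, 0 < N ∧ ∀ j ∈ Finset.Icc (-(M * N : ℤ)) (M * N),
      η ω (cell d N j) < 2 := by
  rw [ae_all_iff]
  intro M
  rw [ae_iff]
  -- The event does not depend on the outer `N`; a union bound over `2M(N+1) + 1` cells of intensity
  -- `λ/(N+1)` gives `O(1/N)`.
  have hle : ∀ N : ℕ, P {ω | ¬ ∃ N : ℕ, 0 < N ∧ ∀ j ∈ Finset.Icc (-(M * N : ℤ)) (M * N),
      η ω (cell d N j) < 2} ≤ ENNReal.ofReal ((2 * M + 1) * lam ^ 2 / (N + 1)) := by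
    intro N
    set n := N + 1 with hn
    have hn0 : (0 : ℝ) < n := by positivity
    have hsub : {ω | ¬ ∃ N : ℕ, 0 < N ∧ ∀ j ∈ Finset.Icc (-(M * N : ℤ)) (M * N),
        η ω (cell d N j) < 2} ⊆ ⋃ j ∈ Finset.Icc (-(M * n : ℤ)) (M * n),
        {ω | 2 ≤ η ω (cell d n j)} := by
      intro ω hω
      simp only [mem_ofPred_eq, not_exists, not_and, not_forall, not_lt] at hω
      obtain ⟨j, hj, hj2⟩ := hω n (Nat.succ_pos _)
      exact mem_biUnion hj hj2
    refine (measure_mono hsub).trans ((measure_biUnion_finset_le _ _).trans ?_)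
    have hj : ∀ j ∈ Finset.Icc (-(M * n : ℤ)) (M * n), P {ω | 2 ≤ η ω (cell d n j)} ≤
        ENNReal.ofReal ((lam / n) ^ 2) := by
      intro j _
      refine (h.prob_two_le (measurableSet_cell n j) ?_).trans ?_
      · rw [cell_measure hlam (Nat.succ_pos _)]; exact ENNReal.ofReal_ne_top
      · rw [cell_measure hlam (Nat.succ_pos _), ENNReal.ofReal_pow (by positivity)]
    refine (Finset.sum_le_sum hj).trans ?_
    rw [Finset.sum_const, Int.card_Icc, nsmul_eq_mul, ← ENNReal.ofReal_natCast,
      ← ENNReal.ofReal_mul (by positivity)]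
    apply ENNReal.ofReal_le_ofReal
    have e : ((M * n + 1 - -(M * n : ℤ)).toNat : ℝ) = 2 * M * n + 1 := by
      have : (M * n + 1 - -(M * n : ℤ)).toNat = 2 * M * n + 1 := by
        rw [show (M * n + 1 - -(M * n : ℤ)) = ((2 * M * n + 1 : ℕ) : ℤ) by push_cast; ring,
          Int.toNat_natCast]
      rw [this]; push_cast; ring
    have hn1 : (1 : ℝ) ≤ n := by rw [hn]; push_cast; linarith [(Nat.cast_nonneg N : (0:ℝ) ≤ N)]
    rw [e, show (N : ℝ) + 1 = n by rw [hn]; push_cast; ring, div_pow, ← mul_div_assoc,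
      div_le_div_iff₀ (by positivity) hn0]
    have : (2 * M * n + 1 : ℝ) ≤ (2 * M + 1) * n := by nlinarith
    nlinarith [mul_le_mul_of_nonneg_right this (by positivity : 0 ≤ lam ^ 2 * n)]
  have hlim : Filter.Tendsto (fun N : ℕ => ENNReal.ofReal ((2 * M + 1) * lam ^ 2 / (N + 1)))
      Filter.atTop (nhds 0) := by
    rw [← ENNReal.ofReal_zero]
    apply ENNReal.tendsto_ofReal
    exact tendsto_const_nhds.div_atTop
      (Filter.tendsto_atTop_add_const_right _ _ tendsto_natCast_atTop_atTop)
  exact le_antisymm (ge_of_tendsto' hlim hle) zero_le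

/-- Almost surely the process is simple and its points have distinct first coordinates. -/
theorem ae_simple (hlam : 0 < lam)
    (h : IsPoissonProcess P η (ENNReal.ofReal lam • (volume : Measure ℝ).prod Θ)) :
    ∀ᵐ ω ∂P, (∀ x, η ω {x} ≠ 0 → η ω {x} = 1) ∧
      ∀ x y, η ω {x} ≠ 0 → η ω {y} ≠ 0 → x.1 = y.1 → x = y := by
  filter_upwards [ae_cells_lt_two hlam h] with ω hω
  have hone : ∀ x, η ω {x} ≠ 0 → 1 ≤ η ω {x} := by
    intro x hx
    obtain ⟨n, hn⟩ := h.counting ω {x} (measurableSet_singleton x)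
    rw [hn] at hx ⊢
    have : n ≠ 0 := by rintro rfl; simp at hx
    exact_mod_cast Order.one_le_iff_ne_zero.2 this
  -- Cells depend on `p` only, so a count below two excludes both a multiple point and two points
  -- with equal `p`.
  have hcell : ∀ x : Param d, ∃ N j, x ∈ cell d N j ∧ (∀ y : Param d, y.1 = x.1 → y ∈ cell d N j) ∧
      η ω (cell d N j) < 2 := by
    intro x
    obtain ⟨M, hM⟩ := exists_nat_ge |x.1|
    obtain ⟨N, hN, hNj⟩ := hω M
    have hN' : (0 : ℝ) < N := by exact_mod_cast hN
    refine ⟨N, ⌊(N : ℝ) * x.1⌋, rfl, fun y hy => by simp [cell, hy], hNj _ ?_⟩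
    have hx := abs_le.1 hM
    rw [Finset.mem_Icc]
    constructor
    · rw [Int.le_floor]; push_cast; nlinarith
    · have : (⌊(N : ℝ) * x.1⌋ : ℝ) ≤ M * N := (Int.floor_le _).trans (by nlinarith)
      exact_mod_cast this
  constructor
  · intro x hx
    obtain ⟨N, j, hxc, -, hlt⟩ := hcell x
    obtain ⟨n, hn⟩ := h.counting ω {x} (measurableSet_singleton x)
    have h2 : η ω {x} < 2 := (measure_mono (singleton_subset_iff.2 hxc)).trans_lt hlt
    have h1 := hone x hx
    rw [hn] at h1 h2 ⊢
    have h1' : 1 ≤ n := by exact_mod_cast h1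
    have h2' : n < 2 := by exact_mod_cast h2
    have : n = 1 := by
      lift n to ℕ using ne_top_of_lt h2'
      have a1 : 1 ≤ n := by exact_mod_cast h1'
      have a2 : n < 2 := by exact_mod_cast h2'
      have : n = 1 := by omega
      simp [this]
    rw [this]; simp
  · intro x y hx hy hxy
    by_contra hne
    obtain ⟨N, j, hxc, hyc, hlt⟩ := hcell x
    have hsub : ({x} ∪ {y} : Set (Param d)) ⊆ cell d N j := by
      rintro z (rfl | rfl)
      · exact hxc
      · exact hyc _ hxy.symm
    have hm := measure_mono (μ := η ω) hsub
    rw [measure_union (by simpa using hne) (measurableSet_singleton y)] at hm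
    have : (2 : ℝ≥0∞) ≤ η ω {x} + η ω {y} := by
      exact one_add_one_eq_two.symm.le.trans (add_le_add (hone x hx) (hone y hy))
    exact absurd (this.trans hm) (not_le.2 hlt)

end Moments

end PoissonHyperplane

/-! ### Factorial moments and the Campbell formula -/

namespace PoissonHyperplane

variable {d : ℕ}

/-- The tuples of parameters whose first coordinates are pairwise distinct. -/
def distinct (d m : ℕ) : Set (Fin m → Param d) := {x | Function.Injective fun i => (x i).1}

/-- A product of cells with pairwise distinct indices. -/
def cellBox (d : ℕ) {m : ℕ} (q : ℕ × (Fin m ↪ ℤ)) : Set (Fin m → Param d) :=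
  univ.pi fun i => cell d (q.1 + 1) (q.2 i)

/-- A fine enough mesh puts distinct coordinates into distinct cells. On each of these countably
many boxes independence over disjoint sets applies. -/
theorem distinct_eq_iUnion (m : ℕ) : distinct d m = ⋃ q : ℕ × (Fin m ↪ ℤ), cellBox d q := by
  ext x
  simp only [distinct, mem_ofPred_eq, mem_iUnion, cellBox, mem_pi, mem_univ, true_implies]
  constructor
  · intro hx
    have hgap : ∃ N : ℕ, ∀ i j, i ≠ j → 1 ≤ ((N + 1 : ℕ) : ℝ) * |(x i).1 - (x j).1| := by
      have h1 : ∀ p : Fin m × Fin m, ∃ N : ℕ, p.1 ≠ p.2 →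
          1 ≤ (N : ℝ) * |(x p.1).1 - (x p.2).1| := by
        intro p
        by_cases hp : p.1 = p.2
        · exact ⟨0, fun h => absurd hp h⟩
        · have hpos : 0 < |(x p.1).1 - (x p.2).1| := abs_pos.2 (sub_ne_zero.2 fun h => hp (hx h))
          obtain ⟨N, hN⟩ := exists_nat_ge (1 / |(x p.1).1 - (x p.2).1|)
          exact ⟨N, fun _ => (div_le_iff₀ hpos).1 hN⟩
      choose f hf using h1
      refine ⟨∑ p, f p, fun i j hij => (hf (i, j) hij).trans ?_⟩
      refine mul_le_mul_of_nonneg_right ?_ (abs_nonneg _)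
      have := Finset.single_le_sum (f := f) (fun p _ => Nat.zero_le _) (Finset.mem_univ (i, j))
      exact_mod_cast this.trans (Nat.le_succ _)
    obtain ⟨N, hN⟩ := hgap
    refine ⟨(N, ⟨fun i => ⌊((N + 1 : ℕ) : ℝ) * (x i).1⌋, fun i j hij => ?_⟩), fun i => rfl⟩
    by_contra hne
    have h1 := hN i j hne
    have h2 := Int.abs_sub_lt_one_of_floor_eq_floor hij
    rw [← mul_sub, abs_mul, abs_of_nonneg (by positivity : (0:ℝ) ≤ ((N + 1 : ℕ) : ℝ))] at h2
    linarith
  · rintro ⟨⟨N, j⟩, hj⟩ a b hab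
    apply j.injective
    rw [← hj a, ← hj b]
    rw [show (x a).1 = (x b).1 from hab]

theorem measurableSet_cellBox {m : ℕ} (q : ℕ × (Fin m ↪ ℤ)) : MeasurableSet (cellBox d q) :=
  MeasurableSet.univ_pi fun _ => measurableSet_cell _ _

theorem countable_embedding (m : ℕ) : Countable (Fin m ↪ ℤ) :=
  Function.Injective.countable (f := fun e : Fin m ↪ ℤ => (e : Fin m → ℤ)) DFunLike.coe_injective

theorem measurableSet_distinct (m : ℕ) : MeasurableSet (distinct d m) := by
  have := countable_embedding m
  rw [distinct_eq_iUnion]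
  exact MeasurableSet.iUnion fun q => measurableSet_cellBox q

section Moments

variable {Ω : Type*} [MeasurableSpace Ω] {P : Measure Ω}
  {η : Ω → Measure (Param d)} {Θ : Measure (upperHemisphere d)} {lam : ℝ}

/-- On a slab the measures are finite and a π-system of boxes suffices; the general case is a
monotone limit over slabs. -/
theorem measurable_pi_process (hloc : ∀ ω, IsLocallyFiniteMeasure (η ω))
    (hmeas : ∀ B, MeasurableSet B → Measurable fun ω => η ω B) (m : ℕ) :
    Measurable fun ω => Measure.pi fun _ : Fin m => η ω := by
  have hM : ∀ M : ℕ, Measurable fun ω => Measure.pi fun _ : Fin m => (η ω).restrict (slab d M) := by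
    intro M
    have hfin : ∀ ω, IsFiniteMeasure ((η ω).restrict (slab d M)) := fun ω =>
      ⟨by rw [Measure.restrict_apply_univ]; exact measure_slab_lt_top (η ω) M⟩
    have hbox : ∀ s : Fin m → Set (Param d), (∀ i, MeasurableSet (s i)) →
        Measurable fun ω => (Measure.pi fun _ : Fin m => (η ω).restrict (slab d M)) (univ.pi s) := by
      intro s hs
      simp_rw [Measure.pi_pi, fun i ω => Measure.restrict_apply (μ := η ω) (s := slab d M) (hs i)]
      exact Finset.measurable_prod _ fun i _ => hmeas _ ((hs i).inter (measurableSet_slab M))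
    refine Measurable.measure_of_isPiSystem generateFrom_pi.symm isPiSystem_pi ?_ ?_
    · rintro _ ⟨s, hs, rfl⟩
      exact hbox s fun i => hs i trivial
    · rw [← pi_univ univ]
      exact hbox _ fun _ => MeasurableSet.univ
  refine Measure.measurable_of_measurable_coe _ fun A hA => ?_
  have hA' : ∀ ω, (Measure.pi fun _ : Fin m => η ω) A =
      ⨆ M : ℕ, (Measure.pi fun _ : Fin m => (η ω).restrict (slab d M)) A := by
    intro ω
    simp_rw [← Measure.restrict_pi_pi, Measure.restrict_apply hA]
    rw [← Monotone.measure_iUnion]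
    · congr 1
      ext x
      simp only [mem_iUnion, mem_inter_iff, exists_and_left, mem_pi, mem_univ, true_implies]
      refine ⟨fun hx => ⟨hx, ?_⟩, fun hx => hx.1⟩
      obtain ⟨M, hM⟩ := exists_nat_ge (∑ i, |(x i).1|)
      exact ⟨M, fun i => (Finset.single_le_sum (f := fun i => |(x i).1|)
        (fun _ _ => abs_nonneg _) (Finset.mem_univ i)).trans hM⟩
    · intro a b hab
      refine inter_subset_inter_right _ (pi_mono fun i _ x hx => ?_)
      exact le_trans (show |x.1| ≤ a from hx) (by exact_mod_cast hab)
  simp_rw [hA']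
  exact Measurable.iSup fun M => (Measure.measurable_coe hA).comp (hM M)

variable [IsProbabilityMeasure P] [IsProbabilityMeasure Θ]

/-- The factorial moment measures of a Poisson process are the powers of its intensity measure. -/
theorem bind_restrict_distinct (hlam : 0 < lam)
    (h : IsPoissonProcess P η (ENNReal.ofReal lam • (volume : Measure ℝ).prod Θ)) (m : ℕ) :
    (P.bind fun ω => Measure.pi fun _ : Fin m => η ω).restrict (distinct d m) =
      (Measure.pi fun _ : Fin m => ENNReal.ofReal lam • (volume : Measure ℝ).prod Θ).restrict
        (distinct d m) := by
  have := countable_embedding m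
  have := h.locallyFinite
  have hpi := measurable_pi_process h.locallyFinite h.measurable m
  set Λ := ENNReal.ofReal lam • (volume : Measure ℝ).prod Θ with hΛ
  have hσ : SigmaFinite Λ := by
    rw [hΛ, ← Measure.prod_smul_left]
    have : (ENNReal.ofReal lam • (volume : Measure ℝ)).IsAddHaarMeasure :=
      Measure.IsAddHaarMeasure.smul _ (ENNReal.ofReal_pos.2 hlam).ne' ENNReal.ofReal_ne_top
    infer_instance
  rw [distinct_eq_iUnion, Measure.restrict_iUnion_congr]
  rintro q
  rw [cellBox, Measure.restrict_pi_pi]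
  symm
  refine Measure.pi_eq fun s hs => ?_
  have hms : MeasurableSet (univ.pi s) := MeasurableSet.univ_pi hs
  have hmc := fun i => (hs i).inter (measurableSet_cell (d := d) (q.1 + 1) (q.2 i))
  rw [Measure.restrict_apply hms, ← pi_inter_distrib,
    Measure.bind_apply (MeasurableSet.univ_pi hmc) hpi.aemeasurable]
  simp_rw [Measure.pi_pi]
  -- Distinct cell indices make these sets disjoint, so the mean of the product of counts is the
  -- product of the intensities.
  have hindep := h.indep m (fun i => s i ∩ cell d (q.1 + 1) (q.2 i)) hmc (by
    intro a b hab
    refine Set.disjoint_left.2 fun x hx hy => hab (q.2.injective ?_)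
    exact hx.2.symm.trans hy.2)
  rw [lintegral_prod_eq_prod_lintegral_of_indepFun Finset.univ _ hindep
    fun i => h.measurable _ (hmc i)]
  refine Finset.prod_congr rfl fun i _ => ?_
  rw [Measure.restrict_apply (hs i)]
  refine h.lintegral_apply (hmc i) (ne_top_of_le_ne_top ?_ (measure_mono inter_subset_right))
  rw [cell_measure hlam (Nat.succ_pos _)]
  exact ENNReal.ofReal_ne_top

/-- Each coincidence `y i = y j` defines a proper, hence Haar-null, subspace. -/
theorem ae_mem_distinct (hlam : 0 < lam) (m : ℕ) :
    ∀ᵐ x ∂(Measure.pi fun _ : Fin m => ENNReal.ofReal lam • (volume : Measure ℝ).prod Θ),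
      x ∈ distinct d m := by
  have hh : (ENNReal.ofReal lam • (volume : Measure ℝ)).IsAddHaarMeasure :=
    Measure.IsAddHaarMeasure.smul _ (ENNReal.ofReal_pos.2 hlam).ne' ENNReal.ofReal_ne_top
  rw [← Measure.prod_smul_left]
  have hmp := measurePreserving_pi
    (fun _ : Fin m => (ENNReal.ofReal lam • (volume : Measure ℝ)).prod Θ)
    (fun _ : Fin m => ENNReal.ofReal lam • (volume : Measure ℝ))
    (f := fun _ => Prod.fst) (fun _ => measurePreserving_fst)
  have hne : ∀ i j : Fin m, i ≠ j → ∀ᵐ y : Fin m → ℝ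
      ∂(Measure.pi fun _ : Fin m => ENNReal.ofReal lam • (volume : Measure ℝ)), y i ≠ y j := by
    intro i j hij
    let U : Submodule ℝ (Fin m → ℝ) := LinearMap.ker
      ((LinearMap.proj i : (Fin m → ℝ) →ₗ[ℝ] ℝ) - LinearMap.proj j)
    have hU : U ≠ ⊤ := by
      intro h
      have : (Pi.single i (1 : ℝ) : Fin m → ℝ) ∈ U := by rw [h]; trivial
      simp only [U, LinearMap.mem_ker, LinearMap.sub_apply, LinearMap.proj_apply,
        Pi.single_eq_same, Pi.single_eq_of_ne hij.symm] at this
      norm_num at this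
    rw [ae_iff]
    refine measure_mono_null ?_ (Measure.addHaar_submodule _ U hU)
    intro y hy
    simp only [ne_eq, not_not, mem_ofPred_eq] at hy
    simp [U, hy]
  have hall := ae_all_iff.2 fun i => ae_all_iff.2 fun j => ae_all_iff.2 fun hij => hne i j hij
  filter_upwards [hmp.quasiMeasurePreserving.ae hall] with x hx
  intro i j hij
  by_contra hc
  exact hx i j hc hij

/-- The multivariate Campbell formula for a Poisson process. -/
theorem lintegral_distinct (hlam : 0 < lam)
    (h : IsPoissonProcess P η (ENNReal.ofReal lam • (volume : Measure ℝ).prod Θ)) (m : ℕ)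
    {f g : (Fin m → Param d) → ℝ≥0∞} (hg : Measurable g)
    (hfg : f =ᵐ[Measure.pi fun _ => ENNReal.ofReal lam • (volume : Measure ℝ).prod Θ] g) :
    AEMeasurable (fun ω => ∫⁻ x in distinct d m, f x ∂(Measure.pi fun _ => η ω)) P ∧
    ∫⁻ ω, ∫⁻ x in distinct d m, f x ∂(Measure.pi fun _ => η ω) ∂P =
      ∫⁻ x, g x ∂(Measure.pi fun _ => ENNReal.ofReal lam • (volume : Measure ℝ).prod Θ) := by
  have hpi := measurable_pi_process h.locallyFinite h.measurable m
  have hD := measurableSet_distinct (d := d) m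
  have hb := bind_restrict_distinct hlam h m
  have hae : ∀ᵐ ω ∂P, ∫⁻ x in distinct d m, f x ∂(Measure.pi fun _ => η ω) =
      ∫⁻ x, (distinct d m).indicator g x ∂(Measure.pi fun _ => η ω) := by
    -- Off the diagonals the mean measure is the power of the intensity, so a null set for the
    -- latter is null for almost every realization; `f` itself need not be measurable.
    have h1 : ∀ᵐ x ∂(P.bind fun ω => Measure.pi fun _ : Fin m => η ω),
        x ∈ distinct d m → f x = g x := by
      rw [← ae_restrict_iff' hD, hb]
      exact ae_restrict_of_ae hfg
    filter_upwards [Measure.ae_ae_of_ae_bind hpi.aemeasurable h1] with ω hω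
    rw [lintegral_indicator hD]
    exact setLIntegral_congr_fun_ae hD hω
  have hmeas : Measurable fun ω =>
      ∫⁻ x, (distinct d m).indicator g x ∂(Measure.pi fun _ => η ω) :=
    (Measure.measurable_lintegral (hg.indicator hD)).comp hpi
  refine ⟨hmeas.aemeasurable.congr (hae.mono fun ω hω => hω.symm), ?_⟩
  rw [lintegral_congr_ae hae, ← Measure.lintegral_bind hpi.aemeasurable
    (hg.indicator hD).aemeasurable, lintegral_indicator hD, hb,
    Measure.restrict_eq_self_of_ae_mem (ae_mem_distinct hlam m)]

end Moments

/-! ### Purely atomic measures -/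

/-- A point that is not an atom has an open neighbourhood of mass below one, hence zero by
integrality. -/
theorem measure_compl_atoms {ψ : Measure (Param d)} [IsLocallyFiniteMeasure ψ]
    (hcount : ∀ B, MeasurableSet B → ∃ n : ℕ∞, ψ B = (n : ℝ≥0∞)) :
    ψ {x | ψ {x} ≠ 0}ᶜ = 0 := by
  refine measure_null_of_locally_null _ fun x hx => ?_
  have h0 : ψ {x} = 0 := by simpa using hx
  obtain ⟨U, hxU, hU, hlt⟩ := Set.exists_isOpen_lt_of_lt (μ := ψ) {x} 1 (by rw [h0]; exact one_pos)
  refine ⟨U, mem_nhdsWithin_of_mem_nhds (hU.mem_nhds (hxU rfl)), ?_⟩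
  obtain ⟨n, hn⟩ := hcount U hU.measurableSet
  rw [hn] at hlt ⊢
  have : n < 1 := by exact_mod_cast hlt
  rw [Order.lt_one_iff.1 this]; simp

theorem countable_atoms (ψ : Measure (Param d)) [SFinite ψ] : {x | ψ {x} ≠ 0}.Countable := by
  have h := Measure.countable_meas_pos_of_disjoint_iUnion (μ := ψ) (As := fun x : Param d => {x})
    (fun x => measurableSet_singleton x) (fun a b hab => by simpa using hab)
  simpa only [pos_iff_ne_zero] using h

/-- For a simple point measure whose atoms have distinct first coordinates, integration of a
function against the power of the measure off the diagonals is summation over tuples of distinct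
atoms. -/
theorem lintegral_distinct_eq_tsum {ψ : Measure (Param d)} [IsLocallyFiniteMeasure ψ]
    (hcount : ∀ B, MeasurableSet B → ∃ n : ℕ∞, ψ B = (n : ℝ≥0∞))
    (hone : ∀ x, ψ {x} ≠ 0 → ψ {x} = 1)
    (hinj : ∀ x y, ψ {x} ≠ 0 → ψ {y} ≠ 0 → x.1 = y.1 → x = y) (m : ℕ)
    (f : (Fin m → Param d) → ℝ≥0∞) :
    ∫⁻ x in distinct d m, f x ∂(Measure.pi fun _ => ψ) =
      ∑' a : Fin m ↪ {x | ψ {x} ≠ 0}, f fun i => a i := by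
  set A : Set (Param d) := {x | ψ {x} ≠ 0} with hA
  have hAc := countable_atoms ψ
  set S : Set (Fin m → Param d) := {x | (∀ i, x i ∈ A) ∧ x ∈ distinct d m} with hS
  have hSc : S.Countable := (countable_pi fun _ : Fin m => hAc).mono fun x hx => hx.1
  have hae : S =ᵐ[Measure.pi fun _ : Fin m => ψ] distinct d m := by
    have h1 : ∀ᵐ x ∂ψ, x ∈ A := by
      rw [ae_iff]; exact measure_compl_atoms hcount
    have h2 : ∀ᵐ x ∂(Measure.pi fun _ : Fin m => ψ), ∀ i, x i ∈ A :=
      ae_all_iff.2 fun i => Measure.tendsto_eval_ae_ae.eventually h1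
    filter_upwards [h2] with x hx
    exact propext ⟨fun h => h.2, fun h => ⟨hx, h⟩⟩
  rw [← setLIntegral_congr hae, lintegral_countable _ hSc]
  let e : (Fin m ↪ A) ≃ S :=
    { toFun := fun a => ⟨fun i => a i, fun i => (a i).2, fun i j hij =>
        a.injective (Subtype.ext (hinj _ _ (a i).2 (a j).2 hij))⟩
      invFun := fun x => ⟨fun i => ⟨x.1 i, x.2.1 i⟩, fun i j hij =>
        x.2.2 (congrArg (fun z : A => z.1.1) hij)⟩
      left_inv := fun a => rfl
      right_inv := fun x => rfl }
  rw [← e.tsum_eq]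
  refine tsum_congr fun a => ?_
  rw [Measure.pi_singleton]
  have : ∀ i, ψ {(e a : Fin m → Param d) i} = 1 := fun i => hone _ (a i).2
  simp_rw [this]
  simp [e]

end PoissonHyperplane

/-! ### From parameters to hyperplanes, and the expectations -/

namespace PoissonHyperplane

variable {d : ℕ}

/-- Hyperplanes with normals in the open upper half space determine their parameters. -/
theorem hyperplane_injective_of_pos {i : Fin d} {x y : Param d} (hx : 0 < normal x i)
    (hy : 0 < normal y i) (h : hyperplane x = hyperplane y) : x = y := by
  have hdir : ∀ w, inner ℝ w (normal x) = 0 → inner ℝ w (normal y) = 0 := by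
    intro w hw
    rw [← direction_hyperplane] at hw ⊢
    rwa [← h]
  -- Equal hyperplanes have parallel unit normals, so `c = ±1`; positivity of coordinate `i`
  -- excludes `-1`.
  set c : ℝ := inner ℝ (normal y) (normal x)
  have hw0 : inner ℝ (normal y - c • normal x) (normal x) = 0 := by
    rw [inner_sub_left, real_inner_smul_left, real_inner_self_eq_norm_sq, norm_normal]
    simp [c]
  have hw1 := hdir _ hw0
  have hz : normal y - c • normal x = 0 := by
    rw [← norm_eq_zero, ← sq_eq_zero_iff, ← real_inner_self_eq_norm_sq]
    conv_lhs => rw [inner_sub_right, real_inner_smul_right, hw0, hw1]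
    simp
  have hyc : normal y = c • normal x := sub_eq_zero.1 hz
  have hc1 : |c| = 1 := by
    have := norm_normal y
    rwa [hyc, norm_smul, norm_normal, mul_one, Real.norm_eq_abs] at this
  have hcpos : 0 < c := by
    have : normal y i = c * normal x i := by rw [hyc]; rfl
    rw [this] at hy
    exact (pos_iff_pos_of_mul_pos hy).2 hx
  have hc : c = 1 := by rwa [abs_of_pos hcpos] at hc1
  have hn : normal y = normal x := by rw [hyc, hc, one_smul]
  have hmem : x.1 • normal x ∈ hyperplane x := by
    rw [mem_hyperplane, real_inner_smul_left, real_inner_self_eq_norm_sq, norm_normal]; simp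
  have hp : x.1 = y.1 := by
    have h1 := hmem
    rw [h, mem_hyperplane, hn, real_inner_smul_left, real_inner_self_eq_norm_sq, norm_normal] at h1
    simpa using h1
  exact Prod.ext hp (Subtype.ext (Subtype.ext hn.symm))

section Moments

variable {Ω : Type*} [MeasurableSpace Ω] {P : Measure Ω} [IsProbabilityMeasure P]
  {Ψ : Ω → Measure (Param d)} {lam : ℝ}

/-- The closed hemisphere may contain both `v` and `-v` on its equator, where `H(p, v) = H(-p, -v)`.
The equator has intensity zero, so almost surely no point lies there. -/
theorem ae_hyperplane_injOn (hd : 0 < d)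
    (h : IsStationaryPoissonHyperplaneProcess P Ψ lam (uniformHemisphere d)) :
    ∀ᵐ ω ∂P, InjOn (hyperplane (d := d)) {x | Ψ ω {x} ≠ 0} := by
  have hprob := isProbabilityMeasure_uniformHemisphere hd
  have h' : IsPoissonProcess P Ψ
    (ENNReal.ofReal lam • (volume : Measure ℝ).prod (uniformHemisphere d)) := h
  set i : Fin d := ⟨d - 1, by omega⟩
  set Z : Set (Param d) := {x | normal x i = 0} with hZ
  have hZm : MeasurableSet Z := measurableSet_eq_fun (by fun_prop) measurable_const
  have hZ0 : (ENNReal.ofReal lam • (volume : Measure ℝ).prod (uniformHemisphere d)) Z = 0 := by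
    have hU : LinearMap.ker (EuclideanSpace.proj i : E d →L[ℝ] ℝ).toLinearMap
        ≠ ⊤ := by
      intro h
      have : EuclideanSpace.single i (1:ℝ) ∈ LinearMap.ker
          (EuclideanSpace.proj i : E d →L[ℝ] ℝ).toLinearMap := by
        rw [h]; trivial
      simp at this
    have h1 := Measure.quasiMeasurePreserving_snd (μ := (volume : Measure ℝ)).ae
      (uniformHemisphere_submodule hd _ hU)
    have h2 : (volume : Measure ℝ).prod (uniformHemisphere d) Z = 0 := by
      refine measure_mono_null ?_ (ae_iff.1 h1)
      intro x hx
      simpa [hZ] using hx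
    rw [Measure.smul_apply, h2, smul_zero]
  have hP : P {ω | Ψ ω Z = ((0 : ℕ) : ℝ≥0∞)} = 1 := by
    rw [h'.poisson Z hZm (by rw [hZ0]; exact ENNReal.zero_ne_top) 0, hZ0, poissonMeasure_singleton]
    simp
  have hae : ∀ᵐ ω ∂P, Ψ ω Z = ((0 : ℕ) : ℝ≥0∞) := by
    rw [ae_iff]
    exact (prob_compl_eq_zero_iff (h'.measurable Z hZm (measurableSet_singleton _))).2 hP
  filter_upwards [hae] with ω hω
  have hpos : ∀ x : Param d, Ψ ω {x} ≠ 0 → 0 < normal x i := by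
    intro x hx
    refine lt_of_le_of_ne (x.2.2 i (by simp only [i]; omega)) fun h0 => hx ?_
    refine measure_mono_null (singleton_subset_iff.2 (show x ∈ Z from h0.symm)) ?_
    rw [hω]; simp
  intro x hx y hy hxy
  exact hyperplane_injective_of_pos (hpos x hx) (hpos y hy) hxy

/-- Expected sums over tuples of distinct hyperplanes of the process. -/
theorem lintegral_tsum_supp (hd : 0 < d) (hlam : 0 < lam)
    (h : IsStationaryPoissonHyperplaneProcess P Ψ lam (uniformHemisphere d)) (m : ℕ)
    (F : AffineSubspace ℝ (E d) → ℝ≥0∞) {g : (Fin m → Param d) → ℝ≥0∞} (hg : Measurable g)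
    (hfg : ∀ x : Fin m → Param d, LinearIndependent ℝ (fun i => normal (x i)) →
      F (⨅ i, hyperplane (x i)) = g x) (hm : m ≤ d) :
    AEMeasurable (fun ω => ∑' H : Fin m ↪ supp (Ψ ω),
      F (⨅ j, (H j : AffineSubspace ℝ (E d)))) P ∧
    ∫⁻ ω, ∑' H : Fin m ↪ supp (Ψ ω), F (⨅ j, (H j : AffineSubspace ℝ (E d))) ∂P =
      ∫⁻ x, g x ∂(Measure.pi fun _ =>
        (ENNReal.ofReal lam • (volume : Measure ℝ)).prod (uniformHemisphere d)) := by
  have hprob := isProbabilityMeasure_uniformHemisphere hd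
  have h' : IsPoissonProcess P Ψ
    (ENNReal.ofReal lam • (volume : Measure ℝ).prod (uniformHemisphere d)) := h
  have hloc := h'.locallyFinite
  have hHaar : (ENNReal.ofReal lam • (volume : Measure ℝ)).IsAddHaarMeasure :=
    Measure.IsAddHaarMeasure.smul _ (ENNReal.ofReal_pos.2 hlam).ne' ENNReal.ofReal_ne_top
  have hgp := ae_linearIndependent_normal hd (τ := ENNReal.ofReal lam • (volume : Measure ℝ)) m hm
  rw [Measure.prod_smul_left] at hgp ⊢
  obtain ⟨h1, h2⟩ := lintegral_distinct hlam h' m (f := fun x => F (⨅ i, hyperplane (x i))) hg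
    (hgp.mono fun x hx => hfg x hx)
  have hae : ∀ᵐ ω ∂P, ∫⁻ x in distinct d m, F (⨅ i, hyperplane (x i))
      ∂(Measure.pi fun _ => Ψ ω) =
      ∑' H : Fin m ↪ supp (Ψ ω), F (⨅ j, (H j : AffineSubspace ℝ (E d))) := by
    filter_upwards [ae_simple hlam h', ae_hyperplane_injOn hd h] with ω ⟨ho, hi⟩ hinj
    rw [lintegral_distinct_eq_tsum (h'.counting ω) ho hi m]
    have hsupp : supp (Ψ ω) = hyperplane '' {x | Ψ ω {x} ≠ 0} := by
      ext H
      simp only [supp, mem_ofPred_eq, mem_image]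
      exact exists_congr fun x => and_congr Iff.rfl eq_comm
    let e : {x | Ψ ω {x} ≠ 0} ≃ supp (Ψ ω) :=
      (Equiv.Set.imageOfInjOn _ _ hinj).trans (Equiv.setCongr hsupp.symm)
    rw [← (Equiv.embeddingCongr (Equiv.refl (Fin m)) e).tsum_eq]
    rfl
  exact ⟨h1.congr hae, by rw [← h2]; exact lintegral_congr_ae (hae.mono fun ω hω => hω.symm)⟩

/-- The whole space is at distance zero, which yields a full ball volume; `1/(d-k)!` turns `d!/k!`
into the binomial coefficient of `flatIntensity`. -/
theorem lintegral_sectionVolume_cut_top (hd : 0 < d) (hlam : 0 < lam) {r : ℝ} (hr : 0 < r)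
    {k : ℕ} (hk : k < d) (n : ℕ) :
    ((d - k)! : ℝ≥0∞)⁻¹ * ∫⁻ x : Fin (d - k) → Param d, sectionVolume n r (cutDist ⊤ x)
      ∂(Measure.pi fun _ =>
        (ENNReal.ofReal lam • (volume : Measure ℝ)).prod (uniformHemisphere d)) =
      ENNReal.ofReal (flatIntensity d k lam * kappa (n + (d - k)) * r ^ (n + (d - k))) := by
  have hHaar : (ENNReal.ofReal lam • (volume : Measure ℝ)).IsAddHaarMeasure :=
    Measure.IsAddHaarMeasure.smul _ (ENNReal.ofReal_pos.2 hlam).ne' ENNReal.ofReal_ne_top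
  rw [lintegral_sectionVolume_cut hd hr.le (c := ENNReal.ofReal lam) (Measure.restrict_smul _ _ _)
    (d - k) n ⊤ ⟨0, trivial⟩
    (by rw [AffineSubspace.direction_top, finrank_top, finrank_euclideanSpace_fin]; omega)]
  have h0 : Metric.infEDist 0 ((⊤ : AffineSubspace ℝ (E d)) : Set (E d)) = 0 :=
    Metric.infEDist_zero_of_mem trivial
  have h1 : sectionVolume (n + (d - k)) r 0 =
      ENNReal.ofReal (kappa (n + (d - k)) * r ^ (n + (d - k))) := by
    rw [sectionVolume, if_pos zero_le]
    simp [Real.sqrt_sq hr.le]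
  have hk1 := kappa_pos d
  have hk2 := kappa_pos k
  have hk3 := kappa_pos (n + (d - k))
  have hf : (0 : ℝ) < ((d - k)! : ℝ) := by positivity
  rw [h0, h1, AffineSubspace.direction_top, finrank_top, finrank_euclideanSpace_fin,
    ← ENNReal.ofReal_prod_of_nonneg fun i _ => meanProj_nonneg _ _, prod_meanProj hd hk,
    ← ENNReal.ofReal_pow hlam.le, ← ENNReal.ofReal_mul (by positivity),
    ← ENNReal.ofReal_mul (by have := kappa_pos (d - 1); positivity), ← ENNReal.ofReal_natCast,
    ← ENNReal.ofReal_inv_of_pos hf, ← ENNReal.ofReal_mul (by positivity)]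
  congr 1
  rw [flatIntensity, Nat.cast_choose ℝ hk.le]
  field_simp

end Moments

end PoissonHyperplane

theorem lemma4p2 {Ω : Type*} [MeasurableSpace Ω] (P : Measure Ω) [IsProbabilityMeasure P]
    (d k : ℕ) (hk : k < d) (lam : ℝ) (hlam : 0 < lam)
    (Ψ : Ω → Measure (Param d))
    (hΨ : IsStationaryPoissonHyperplaneProcess P Ψ lam (uniformHemisphere d))
    (r : ℝ) (hr : 0 < r) :
    (AEMeasurable (fun ω => numberHitting k (Ψ ω) r) P ∧
      ∫⁻ ω, numberHitting k (Ψ ω) r ∂P =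
        ENNReal.ofReal (flatIntensity d k lam * kappa (d - k) * r ^ (d - k))) ∧
    (AEMeasurable (fun ω => totalVolume k (Ψ ω) (originBall d r)) P ∧
      ∫⁻ ω, totalVolume k (Ψ ω) (originBall d r) ∂P =
        ENNReal.ofReal (flatIntensity d k lam * kappa d * r ^ d)) ∧
    sigmaChi k r (uniformHemisphere d) = ENNReal.ofReal
      ((kappa (d - k - 1) * ((d - k - 1)! : ℝ)) ^ 2 / ((2 * d - 2 * k - 1)! : ℝ) *
        (((d)! : ℝ) * kappa d / (((k)! : ℝ) * kappa k)) ^ 2 *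
        (kappa (d - 1) / (d * kappa d)) ^ (2 * (d - k))) ∧
    sigmaNu k r (uniformHemisphere d) = ENNReal.ofReal
      ((2 ^ k * kappa (d - 1) * ((d - 1)! : ℝ)) ^ 2 / ((2 * d - 1)! : ℝ) *
        (((d)! : ℝ) * kappa d / (((k)! : ℝ) * kappa k)) ^ 2 *
        (kappa (d - 1) / (d * kappa d)) ^ (2 * (d - k))) := by

  have hd : 0 < d := by omega
  refine ⟨?_, ?_, sigmaChi_eq k hk hr, sigmaNu_eq k hk hr⟩
  · obtain ⟨h1, h2⟩ := lintegral_tsum_supp hd hlam hΨ (d - k)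
      ({L | L ∈ flats d k ∧ ((L : Set (E d)) ∩ originBall d r).Nonempty}.indicator fun _ => 1)
      (g := fun x => sectionVolume 0 r (cutDist ⊤ x))
      ((measurable_sectionVolume 0 r).comp (measurable_infEDist_iInf ⊤)) (fun x hx => by
        obtain ⟨hne, hdim⟩ := cut_top_of_linearIndependent hx
        rw [← chi_inter_originBall _ hr.le, chi]
        rw [cut, top_inf_eq] at hne hdim ⊢
        rw [Nat.sub_sub_self hk.le] at hdim
        classical
        rw [indicator_apply]
        -- In general position the intersection is automatically a `k`-flat, so only hitting the
        -- ball matters.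
        refine if_congr ⟨fun h => h.2, fun h => ⟨⟨hne, hdim⟩, h⟩⟩ rfl rfl) (Nat.sub_le _ _)
    refine ⟨h1.const_mul _, ?_⟩
    simp only [numberHitting, flatProcess]
    rw [lintegral_const_mul'' _ h1, h2, lintegral_sectionVolume_cut_top hd hlam hr hk]
    simp only [zero_add]
  · obtain ⟨h1, h2⟩ := lintegral_tsum_supp hd hlam hΨ (d - k)
      (fun L => nu d k ((L : Set (E d)) ∩ originBall d r))
      (g := fun x => sectionVolume k r (cutDist ⊤ x))
      ((measurable_sectionVolume k r).comp (measurable_infEDist_iInf ⊤)) (fun x hx => by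
        obtain ⟨hne, hdim⟩ := cut_top_of_linearIndependent hx
        rw [Nat.sub_sub_self hk.le] at hdim
        rw [← nu_inter_originBall _ hne hdim hr.le, cut, top_inf_eq]) (Nat.sub_le _ _)
    refine ⟨h1.const_mul _, ?_⟩
    simp only [totalVolume]
    rw [lintegral_const_mul'' _ h1, h2, lintegral_sectionVolume_cut_top hd hlam hr hk,
      Nat.add_sub_cancel' hk.le]
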